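/- Let $n\ge 3$ and $0<q<1$. Let $\tilde e_1,\dots,\tilde e_n$ be the canonical basis of $\mathbb{R}^n$, let $e_i=\tilde e_i-\frac1n(\tilde e_1+\dots+\tilde e_n)$, and let $L$ be the lattice spanned by $e_1,\dots,e_n$. Every $x\in L$ is uniquely of the form $x=\sum_i x_ie_i$ with $x_i\in\mathbb{N}$ and at least one $x_i=0$; write $x=(x_1,\dots,x_n)$ and $|x|=\sum_i x_i$. Let $$\overset{o}{W}=\{x\in L:\ x_1>x_2>\dots>x_n=0\},\qquad \rho=(n-1,n-2,\dots,0)\in\overset{o}{W}.$$ For $x,y\in\overset{o}{W}$ let $\overset{o}{P}(x,y)=q/n$ if $y-x=e_i$ for some $i$, and $\overset{o}{P}(x,y)=0$ otherwise. Let $\overset{o}{P}{}^m$ be the iterates of this kernel, with $\overset{o}{P}{}^0(x,y)=\delta_{x,y}$, and let $\overset{o}{U}(x,y)=\sum_{m\ge 0}\overset{o}{P}{}^m(x,y)$ be its Green kernel. Let $\Sigma=\{y'\in\mathbb{R}^n:\ y_1'\ge\dots\ge y_n'=0,\ \sum_i y_i'=1\}$ and $A_q=\{y''\in\mathbb{R}^n:\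 y_1''\ge\dots\ge y_n''\ge 0,\ \prod_i y_i''=1,\ \sum_i y_i''=nq^{-1}\}$. Define $\phi:\Sigma\to A_q$ by $\phi(y')=y''$ with $$y_i''=\frac{n\,(y_i'+t)}{q\,(1+nt)},\qquad\text{where } t\ge 0 \text{ is the unique number such that } \prod_{i=1}^n\frac{n\,(y_i'+t)}{q\,(1+nt)}=1 .$$ For a partition $\lambda=(\lambda_1\ge\dots\ge\lambda_n\ge0)$ let $s_\lambda$ be the Schur polynomial, that is, the polynomial $$s_\lambda(Y_1,\dots,Y_n)=\frac{\det\bigl(Y_i^{\lambda_j+n-j}\bigr)_{i,j}}{\prod_{1\le i<j\le n}(Y_i-Y_j)} .$$ Let $(y^d)_{d\in\mathbb{N}}$ be a sequence in $\overset{o}{W}$ that converges to $y'\in\Sigma$, in the sense that $|y^d|\to\infty$ and $y^d_i/|y^d|\to y'_i$ for every $i$. Then for every $x\in\overset{o}{W}$, with $x-\rho=(x_j-(n-j))_{j}$, the numbers $\overset{o}{U}(x,y^d)$ and $\overset{o}{U}(\rho,y^d)$ are finite, $\overset{o}{U}(\rho,y^d)>0$, and $$\lim_{d\to\infty}\frac{\overset{o}{U}(x,y^d)}{\overset{o}{U}(\rho,y^d)}=s_{x-\rho}(y''),\qquad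 y''=\phi(y')\in A_q .$$ -/

import Mathlib

open Filter Topology
open scoped ENNReal

noncomputable section

namespace WeylWalk

/-- The vector `e_i = ẽ_i - (ẽ_1 + … + ẽ_n) / n` of `ℝⁿ`, where `ẽ` is the canonical basis. -/
def stepVec {n : ℕ} (i : Fin n) : EuclideanSpace ℝ (Fin n) :=
  EuclideanSpace.single i 1 - (n : ℝ)⁻¹ • ∑ j : Fin n, EuclideanSpace.single j (1 : ℝ)

/-- The open Weyl chamber: the points of the lattice spanned by the `e_i` whose coordinates
(the unique natural numbers, one of them zero, with `x = ∑ x_i e_i`) satisfy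
`x_1 > x_2 > … > x_n = 0`. A point is given by its coordinates; `Chamber.point` is the
corresponding element of the lattice. -/
@[ext]
structure Chamber (n : ℕ) where
  coord : Fin n → ℕ
  strictAnti : StrictAnti coord
  last_eq_zero : ∀ i : Fin n, (i : ℕ) + 1 = n → coord i = 0

/-- The element `∑ x_i e_i` of the lattice. -/
def Chamber.point {n : ℕ} (x : Chamber n) : EuclideanSpace ℝ (Fin n) :=
  ∑ i : Fin n, (x.coord i : ℝ) • stepVec i

/-- The length `|x| = ∑ x_i`. -/
def Chamber.length {n : ℕ} (x : Chamber n) : ℕ := ∑ i : Fin n, x.coord i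

theorem Chamber.point_apply {n : ℕ} (x : Chamber n) (j : Fin n) :
    x.point j = (x.coord j : ℝ) - (n : ℝ)⁻¹ * (x.length : ℝ) := by
  simp only [Chamber.point, Chamber.length, stepVec, Nat.cast_sum]
  simp [Pi.single_apply, sub_mul, Finset.sum_sub_distrib, Finset.mul_sum, mul_comm]

/-- The coordinates are determined by the lattice point. -/
theorem Chamber.point_injective {n : ℕ} : Function.Injective (Chamber.point (n := n)) := by
  intro x y h
  have hj : ∀ j, (x.coord j : ℝ) - (n : ℝ)⁻¹ * (x.length : ℝ)
      = (y.coord j : ℝ) - (n : ℝ)⁻¹ * (y.length : ℝ) := fun j => by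
    rw [← Chamber.point_apply, ← Chamber.point_apply, h]
  ext j
  have hn : n - 1 < n := Nat.sub_lt j.pos Nat.one_pos
  have hl := hj ⟨n - 1, hn⟩
  rw [x.last_eq_zero _ (Nat.sub_add_cancel j.pos),
    y.last_eq_zero _ (Nat.sub_add_cancel j.pos)] at hl
  have h2 := hj j
  have h3 : (x.coord j : ℝ) = (y.coord j : ℝ) := by linarith
  exact_mod_cast h3

/-- The vector `ρ = (n - 1, n - 2, …, 0)`. -/
def rho (n : ℕ) : Chamber n where
  coord j := n - 1 - (j : ℕ)
  strictAnti := fun i j h => by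
    have h1 : (i : ℕ) < j := h
    have h2 := j.isLt
    show n - 1 - (j : ℕ) < n - 1 - (i : ℕ)
    omega
  last_eq_zero := fun i h => by omega

/-- Every point `x` of the open chamber satisfies `ρ_j ≤ x_j`, so that the natural number
subtraction in `Chamber.subRho` does not truncate. -/
theorem Chamber.rho_le {n : ℕ} (x : Chamber n) (j : Fin n) : (rho n).coord j ≤ x.coord j := by
  show n - 1 - (j : ℕ) ≤ x.coord j
  have key : ∀ m : ℕ, ∀ j : Fin n, n - 1 - (j : ℕ) = m → m ≤ x.coord j := by
    intro m
    induction m with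
    | zero => intro j _; exact Nat.zero_le _
    | succ m ih =>
      intro j hj
      have hlt : (j : ℕ) + 1 < n := by omega
      have h1 := ih ⟨(j : ℕ) + 1, hlt⟩ (by show n - 1 - ((j : ℕ) + 1) = m; omega)
      have h2 : x.coord ⟨(j : ℕ) + 1, hlt⟩ < x.coord j :=
        x.strictAnti (show (j : ℕ) < (j : ℕ) + 1 by omega)
      omega
  exact key _ j rfl

/-- The coordinates of `x - ρ`. -/
def Chamber.subRho {n : ℕ} (x : Chamber n) : Fin n → ℕ := fun j => x.coord j - (rho n).coord j

/-! ### The killed random walk and its Green kernel -/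

open Classical in
/-- The transition kernel of the walk with increments `∑ (q / n) δ_{e_i}` killed when it
leaves the open chamber. -/
def kernel {n : ℕ} (q : ℝ) (x y : Chamber n) : ℝ≥0∞ :=
  if ∃ i : Fin n, y.point - x.point = stepVec i then ENNReal.ofReal (q / n) else 0

open Classical in
/-- The iterates of the kernel. -/
def kernelPow {n : ℕ} (q : ℝ) : ℕ → Chamber n → Chamber n → ℝ≥0∞
  | 0 => fun x y => if x = y then 1 else 0
  | m + 1 => fun x y => ∑' z : Chamber n, kernelPow q m x z * kernel q z y

/-- The Green kernel. -/
def green {n : ℕ} (q : ℝ) (x y : Chamber n) : ℝ≥0∞ := ∑' m : ℕ, kernelPow q m x y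

/-! ### The boundary simplex -/

/-- The simplex `y'_1 ≥ … ≥ y'_n = 0`, `∑ y'_i = 1`. -/
abbrev Simplex (n : ℕ) : Type :=
  {y : Fin n → ℝ // Antitone y ∧ (∀ i : Fin n, (i : ℕ) + 1 = n → y i = 0) ∧ ∑ i, y i = 1}

/-- The sequence `y^d` converges to the boundary point `y'`: the lengths `|y^d|` tend to
infinity and `y^d_i / |y^d| → y'_i` for all `i`. -/
def ConvergesTo {n : ℕ} (y : ℕ → Chamber n) (y' : Simplex n) : Prop :=
  Tendsto (fun d => (y d).length) atTop atTop ∧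
    ∀ i : Fin n, Tendsto (fun d => ((y d).coord i : ℝ) / ((y d).length : ℝ)) atTop (𝓝 (y'.1 i))

/-- The set `A_q`: `y''_1 ≥ … ≥ y''_n ≥ 0`, `∏ y''_i = 1`, `∑ y''_i = n q⁻¹`. -/
abbrev A (n : ℕ) (q : ℝ) : Type :=
  {y : Fin n → ℝ // Antitone y ∧ (∀ i, 0 ≤ y i) ∧ ∏ i, y i = 1 ∧ ∑ i, y i = n * q⁻¹}

/-- `q⁻¹ n (y'_i + t) / (1 + n t)`. -/
def shifted {n : ℕ} (q : ℝ) (y : Fin n → ℝ) (t : ℝ) (i : Fin n) : ℝ :=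
  q⁻¹ * n * (y i + t) / (1 + n * t)

theorem Simplex.pos {n : ℕ} (y : Simplex n) : 0 < n := by
  rcases Nat.eq_zero_or_pos n with h | h
  · subst h
    have := y.2.2.2
    simp at this
  · exact h

theorem Simplex.nonneg {n : ℕ} (y : Simplex n) (i : Fin n) : 0 ≤ y.1 i := by
  have hn : n - 1 < n := Nat.sub_lt i.pos Nat.one_pos
  have h0 := y.2.2.1 ⟨n - 1, hn⟩ (Nat.sub_add_cancel i.pos)
  have h1 := y.2.1 (show i ≤ ⟨n - 1, hn⟩ from Nat.le_sub_one_of_lt i.isLt)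
  linarith

theorem exists_shift {n : ℕ} {q : ℝ} (hq0 : 0 < q) (hq1 : q < 1) (y : Simplex n) :
    ∃ t : ℝ, 0 ≤ t ∧ ∏ i, shifted q y.1 t i = 1 := by
  have hn : (0 : ℝ) < n := by exact_mod_cast y.pos
  have h1q : 0 < 1 - q := by linarith
  set T : ℝ := q / (n * (1 - q)) with hT
  have hT0 : 0 ≤ T := by positivity
  have hnT : (n : ℝ) * T = q / (1 - q) := by rw [hT]; field_simp
  have hcont : ContinuousOn (fun t => ∏ i, shifted q y.1 t i) (Set.Icc 0 T) := by
    refine continuousOn_finsetProd _ fun i _ => ?_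
    refine ContinuousOn.div (by fun_prop) (by fun_prop) fun t ht => ?_
    have : 0 ≤ (n : ℝ) * t := mul_nonneg hn.le ht.1
    positivity
  have hzero : (∏ i, shifted q y.1 0 i) = 0 := by
    have hlt : n - 1 < n := Nat.sub_lt y.pos Nat.one_pos
    refine Finset.prod_eq_zero (Finset.mem_univ ⟨n - 1, hlt⟩) ?_
    simp [shifted, y.2.2.1 ⟨n - 1, hlt⟩ (Nat.sub_add_cancel y.pos)]
  have hone : 1 ≤ ∏ i, shifted q y.1 T i := by
    refine Finset.prod_induction _ (1 ≤ ·) (fun a b => one_le_mul_of_one_le_of_one_le) le_rfl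
      fun i _ => ?_
    have h1 : (1 : ℝ) + n * T = 1 / (1 - q) := by rw [hnT]; field_simp; ring
    have h2 : 0 ≤ (n : ℝ) * y.1 i := mul_nonneg hn.le (y.nonneg i)
    have h3 : shifted q y.1 T i = q⁻¹ * (1 - q) * (n * y.1 i) + 1 := by
      simp only [shifted]
      rw [h1, mul_assoc q⁻¹, mul_add, hnT]
      field_simp
    rw [h3]
    have : 0 ≤ q⁻¹ * (1 - q) * (n * y.1 i) := by positivity
    linarith
  obtain ⟨t, ht, hv⟩ := intermediate_value_Icc hT0 hcont
    (show (1 : ℝ) ∈ Set.Icc _ _ from ⟨by simp only [hzero]; norm_num, hone⟩)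
  exact ⟨t, ht.1, hv⟩

theorem shift_unique_aux {n : ℕ} {q : ℝ} (hq0 : 0 < q) (hq1 : q < 1) (y : Simplex n)
    {s t : ℝ} (hs : 0 ≤ s) (hst : s < t) (hps : ∏ i, shifted q y.1 s i = 1) :
    1 < ∏ i, shifted q y.1 t i := by
  have hn : (0 : ℝ) < n := by exact_mod_cast y.pos
  have hs1 : 0 < 1 + n * s := by positivity
  have hlt : 1 + n * s < 1 + n * t := by nlinarith
  have ht1 : 0 < 1 + n * t := hs1.trans hlt
  set l : ℝ := (1 + n * s) / (1 + n * t) with hl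
  have hl0 : 0 ≤ l := by positivity
  have hl1 : l < 1 := by rw [hl, div_lt_one ht1]; exact hlt
  have ha : ∀ i, 0 ≤ shifted q y.1 s i := fun i => by
    have := y.nonneg i
    simp only [shifted]
    positivity
  have hb : ∀ i, shifted q y.1 t i = l * shifted q y.1 s i + (1 - l) * q⁻¹ := fun i => by
    simp only [shifted, hl]
    field_simp
    ring
  have hqi : 1 < q⁻¹ := (one_lt_inv₀ hq0).2 hq1
  have hle : ∀ i, shifted q y.1 s i ^ l * q⁻¹ ^ (1 - l) ≤ shifted q y.1 t i := fun i => by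
    rw [hb]
    exact Real.geom_mean_le_arith_mean2_weighted hl0 (by linarith) (ha i) (by positivity)
      (by ring)
  have hprod : ∏ i : Fin n, (shifted q y.1 s i ^ l * q⁻¹ ^ (1 - l)) ≤ ∏ i, shifted q y.1 t i :=
    Finset.prod_le_prod (fun i _ => mul_nonneg (Real.rpow_nonneg (ha i) _) (by positivity))
      fun i _ => hle i
  refine lt_of_lt_of_le ?_ hprod
  rw [Finset.prod_mul_distrib, Real.finsetProd_rpow _ _ (fun i _ => ha i), hps, Real.one_rpow,
    one_mul, Finset.prod_const, Finset.card_univ, Fintype.card_fin]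
  exact one_lt_pow₀ (Real.one_lt_rpow hqi (by linarith)) y.pos.ne'

/-- The nonnegative parameter `t` in the definition of `phi` exists and is unique. -/
theorem existsUnique_shift {n : ℕ} {q : ℝ} (hq0 : 0 < q) (hq1 : q < 1) (y : Simplex n) :
    ∃! t : ℝ, 0 ≤ t ∧ ∏ i, shifted q y.1 t i = 1 := by
  obtain ⟨t, ht, hp⟩ := exists_shift hq0 hq1 y
  refine ⟨t, ⟨ht, hp⟩, fun s hs => ?_⟩
  rcases lt_trichotomy s t with h | h | h
  · exact absurd hp (shift_unique_aux hq0 hq1 y hs.1 h hs.2).ne'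
  · exact h
  · exact absurd hs.2 (shift_unique_aux hq0 hq1 y ht h hp).ne'

/-- The map `φ` from the simplex to `A_q`: `y''_i = q⁻¹ n (y'_i + t) / (1 + n t)`, where
`t ≥ 0` is the unique number that makes the product of the `y''_i` equal to `1`. -/
def phi {n : ℕ} {q : ℝ} (hq0 : 0 < q) (hq1 : q < 1) (y : Simplex n) : A n q :=
  ⟨shifted q y.1 (existsUnique_shift hq0 hq1 y).choose, by
    obtain ⟨ht, hp⟩ := (existsUnique_shift hq0 hq1 y).choose_spec.1
    set t := (existsUnique_shift hq0 hq1 y).choose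
    have hn : (0 : ℝ) < n := by exact_mod_cast y.pos
    refine ⟨fun i j hij => ?_, fun i => ?_, hp, ?_⟩
    · have := y.2.1 hij
      simp only [shifted]
      gcongr
    · have := y.nonneg i
      simp only [shifted]
      positivity
    · simp only [shifted]
      rw [← Finset.sum_div, ← Finset.mul_sum, Finset.sum_add_distrib, y.2.2.2]
      simp only [Finset.sum_const, Finset.card_univ, Fintype.card_fin, nsmul_eq_mul]
      field_simp⟩

/-! ### Schur polynomials -/

open MvPolynomial

/-- The Vandermonde product `∏_{i < j} (Y_i - Y_j)`. -/
def vandermondePoly (n : ℕ) : MvPolynomial (Fin n) ℝ :=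
  ∏ p : Fin n × Fin n with p.1 < p.2, (X p.1 - X p.2)

/-- The alternant `det (Y_i ^ m_j)`. -/
def alternant {n : ℕ} (m : Fin n → ℕ) : MvPolynomial (Fin n) ℝ :=
  (Matrix.of fun i j : Fin n => (X i : MvPolynomial (Fin n) ℝ) ^ m j).det

theorem X_sub_X_dvd_iff {n : ℕ} (i j : Fin n) (f : MvPolynomial (Fin n) ℝ) :
    (X i - X j) ∣ f ↔ aeval (Function.update X i (X j) : Fin n → MvPolynomial (Fin n) ℝ) f = 0 := by
  constructor
  · rintro ⟨g, rfl⟩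
    by_cases h : j = i
    · subst h; simp
    · simp [Function.update_of_ne h]
  · intro h
    have key : (X i - X j) ∣
        f - aeval (Function.update X i (X j) : Fin n → MvPolynomial (Fin n) ℝ) f := by
      rw [← Ideal.mem_span_singleton, ← Ideal.Quotient.eq]
      have : (Ideal.Quotient.mkₐ ℝ (Ideal.span {(X i - X j : MvPolynomial (Fin n) ℝ)})) =
          (Ideal.Quotient.mkₐ ℝ (Ideal.span {(X i - X j : MvPolynomial (Fin n) ℝ)})).comp
            (aeval (Function.update X i (X j))) := by
        refine MvPolynomial.algHom_ext fun k => ?_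
        rw [AlgHom.comp_apply, aeval_X]
        by_cases hk : k = i
        · subst hk
          rw [Function.update_self]
          exact Ideal.Quotient.eq.2 (Ideal.mem_span_singleton_self _)
        · rw [Function.update_of_ne hk]
      exact DFunLike.congr_fun this f
    rwa [h, sub_zero] at key

theorem X_sub_X_prime {n : ℕ} {i j : Fin n} (h : i ≠ j) :
    Prime (X i - X j : MvPolynomial (Fin n) ℝ) := by
  refine ⟨sub_ne_zero.2 fun e => h (X_injective e), fun hu => ?_, fun a b hab => ?_⟩
  · have h1 := (X_sub_X_dvd_iff i j 1).1 hu.dvd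
    simp at h1
  · rw [X_sub_X_dvd_iff] at hab ⊢
    rw [X_sub_X_dvd_iff]
    rwa [map_mul, mul_eq_zero] at hab

/-- The quotient in the definition of the Schur polynomials is a polynomial. -/
theorem vandermondePoly_dvd_alternant {n : ℕ} (m : Fin n → ℕ) :
    vandermondePoly n ∣ alternant m := by
  refine Finset.prod_dvd_of_isRelPrime ?_ ?_
  · rintro ⟨i, j⟩ hij ⟨k, l⟩ hkl hne
    have hij' : i < j := by simpa using hij
    have hkl' : k < l := by simpa using hkl
    refine ((X_sub_X_prime hij'.ne).irreducible.isRelPrime_iff_not_dvd).2 fun hd => ?_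
    obtain ⟨g, hg⟩ := hd
    have hev : ∀ v : Fin n → ℝ, v i = v j → v k = v l := fun v hv => by
      have := congrArg (eval v) hg
      simp only [map_sub, map_mul, eval_X, hv, sub_self, zero_mul] at this
      linarith
    by_cases hk : k = i ∨ k = j
    · by_cases hl : l = i ∨ l = j
      · apply hne
        rcases hk with rfl | rfl <;> rcases hl with rfl | rfl
        · exact absurd hkl' (lt_irrefl _)
        · rfl
        · exact absurd hkl' hij'.asymm
        · exact absurd hkl' (lt_irrefl _)
      · push Not at hl
        have := hev (Pi.single l 1) (by simp [hl.1.symm, hl.2.symm])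
        simp [hkl'.ne] at this
    · push Not at hk
      have := hev (Pi.single k 1) (by simp [hk.1.symm, hk.2.symm])
      simp [hkl'.ne'] at this
  · rintro ⟨i, j⟩ hij
    have hij' : i < j := by simpa using hij
    rw [X_sub_X_dvd_iff, alternant, AlgHom.map_det]
    refine Matrix.det_zero_of_row_eq hij'.ne ?_
    funext k
    simp [Function.update_of_ne hij'.ne']

/-- The Schur polynomial `s_λ(Y) = det (Y_i ^ (λ_j + n - j)) / ∏_{i < j} (Y_i - Y_j)`, with
`i, j` numbered from `1` (here `Fin n` is numbered from `0`): the exact quotient of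
polynomials, see `schur_mul_vandermondePoly`. -/
def schur {n : ℕ} (lam : Fin n → ℕ) : MvPolynomial (Fin n) ℝ :=
  (vandermondePoly_dvd_alternant fun j => lam j + (n - 1 - (j : ℕ))).choose

theorem schur_mul_vandermondePoly {n : ℕ} (lam : Fin n → ℕ) :
    schur lam * vandermondePoly n = alternant fun j => lam j + (n - 1 - (j : ℕ)) := by
  rw [mul_comm]
  exact (vandermondePoly_dvd_alternant _).choose_spec.symm

end WeylWalk

end

/-! Since the `e_i` sum to zero, the lattice is `ℤⁿ` modulo `(1, …, 1)`. A path of `m` steps from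
`x` to `y` lifts to a path in `ℤⁿ` with unit steps, ending at `Y = y + (k, …, k)` with `m = |y| + nk
- |x|`. Paths staying in the chamber are counted by `m! det (1 / (Y_i - x_j)!)` (`kernelPow_eq`), so
the Green kernel is a series of such terms over `k ≥ 0`.

Pulling `1 / Y_i!` out of the rows leaves a determinant of falling factorials, which is the
Vandermonde product times a factorial Schur function (`det_eval_fallingPoly`); for `ρ` this function
is 1. Hence `U(x, y) / U(ρ, y)` is an average of `weightRatio` with the terms of `U(ρ, y)` as
weights (`greenTerm_eq_mul`). Put `S = |y| + nk` and `u = |y| / S`. The rescaled lift `(n/q) Y / S`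
is `profile` at `y / |y|` and `u`, and as the mesh `1 / S` tends to 0 the ratio becomes the Schur
polynomial at that profile.

The weights concentrate. The ratio of the `k`-th weight to the next tends to the product of the
coordinates of the profile (`greenTerm_rho_succ`). By weighted AM-GM this product exceeds 1 below
`u₀ = 1 / (1 + nt)`, equals 1 there, and is less than 1 above (`Simplex.one_lt_prod_profile`). So
the mass gathers where `u` is close to `u₀` (`tendsto_weighted_average`), and the profile at `u₀` is
`φ(y')`. -/

namespace WeylWalk

open scoped Nat

/-! ### Determinants of reciprocal factorials -/

/-- The reciprocal factorial `1 / a!`, extended by `0` to negative integers. -/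
noncomputable def recipFactorial (a : ℤ) : ℝ := if 0 ≤ a then ((a.toNat)! : ℝ)⁻¹ else 0

theorem recipFactorial_of_neg {a : ℤ} (h : a < 0) : recipFactorial a = 0 := by
  simp [recipFactorial, h]

theorem recipFactorial_natCast (a : ℕ) : recipFactorial a = (a ! : ℝ)⁻¹ := by
  simp [recipFactorial]

/-- The extension by zero makes the recursion hold at every integer, including `a = 0`. -/
theorem recipFactorial_sub_one (a : ℤ) : recipFactorial (a - 1) = recipFactorial a * a := by
  rcases lt_trichotomy a 0 with h | rfl | h
  · rw [recipFactorial_of_neg h, recipFactorial_of_neg (by omega), zero_mul]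
  · rw [recipFactorial_of_neg (by norm_num)]; simp
  · obtain ⟨b, rfl⟩ : ∃ b : ℕ, a = (b + 1 : ℕ) := ⟨(a - 1).toNat, by omega⟩
    have : ((b + 1 : ℕ) : ℤ) - 1 = (b : ℕ) := by push_cast; ring
    rw [this, recipFactorial_natCast, recipFactorial_natCast, Nat.factorial_succ]
    push_cast
    field_simp

/-- In the Leibniz expansion the term of `σ` acquires the factor `∑ (a i - b (σ⁻¹ i))`, which does
not depend on `σ`. -/
theorem sum_det_scale_row {ι : Type*} [Fintype ι] [DecidableEq ι] (A : Matrix ι ι ℝ)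
    (a b : ι → ℝ) :
    ∑ i, (Matrix.of fun r j => if r = i then A r j * (a r - b j) else A r j).det =
      (∑ i, a i - ∑ i, b i) * A.det := by
  simp only [Matrix.det_apply', Matrix.of_apply]
  rw [Finset.sum_comm, Finset.mul_sum]
  refine Finset.sum_congr rfl fun σ _ => ?_
  have h : ∀ i, ∏ c, (if σ c = i then A (σ c) c * (a (σ c) - b c) else A (σ c) c) =
      (∏ c, A (σ c) c) * (a i - b (σ.symm i)) := fun i => by
    have h1 : ∀ c, (if σ c = i then A (σ c) c * (a (σ c) - b c) else A (σ c) c) =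
        A (σ c) c * (if c = σ.symm i then a (σ c) - b c else 1) := fun c => by
      by_cases hc : σ c = i
      · subst hc; simp
      · rw [if_neg hc, if_neg (fun e => hc (by simp [e])), mul_one]
    simp only [h1, Finset.prod_mul_distrib]
    simp
  simp only [h]
  rw [← Finset.mul_sum, ← Finset.mul_sum, Finset.sum_sub_distrib, Equiv.sum_comp σ.symm b]
  ring

/-- The determinant of the reciprocal factorials `1 / (Y_i - x_j)!`. -/
noncomputable def pathDet {n : ℕ} (x Y : Fin n → ℤ) : ℝ :=
  (Matrix.of fun i j => recipFactorial (Y i - x j)).det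

/-- This is the recursion over the last step of a path, up to the factor `m!`. -/
theorem sum_pathDet_sub_single {n : ℕ} (x Y : Fin n → ℤ) :
    ∑ i, pathDet x (Y - Pi.single i 1) = ((∑ i, Y i - ∑ i, x i : ℤ) : ℝ) * pathDet x Y := by
  have h := sum_det_scale_row (Matrix.of fun i j => recipFactorial (Y i - x j))
    (fun i => (Y i : ℝ)) (fun i => (x i : ℝ))
  rw [pathDet]
  push_cast
  rw [← h]
  refine Finset.sum_congr rfl fun i _ => ?_
  rw [pathDet]
  congr 1
  ext r j
  by_cases hr : r = i
  · subst hr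
    simp only [Matrix.of_apply, Pi.sub_apply, Pi.single_eq_same, if_true]
    rw [sub_right_comm, recipFactorial_sub_one]
    push_cast
    rfl
  · simp [hr]

/-- The killing condition: a unit step that breaks strict decrease makes two coordinates equal,
hence two rows equal. -/
theorem pathDet_eq_zero_of_not_strictAnti {n : ℕ} (x Y : Fin n → ℤ) (hY : StrictAnti Y)
    (i : Fin n) (h : ¬ StrictAnti (Y - Pi.single i 1)) : pathDet x (Y - Pi.single i 1) = 0 := by
  simp only [StrictAnti] at h
  push Not at h
  obtain ⟨a, b, hab, hle⟩ := h
  have h1 := hY hab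
  have heq : (Y - Pi.single i 1 : Fin n → ℤ) a = (Y - Pi.single i 1 : Fin n → ℤ) b := by
    simp only [Pi.sub_apply, Pi.single_apply] at hle ⊢
    have : a ≠ b := hab.ne
    split_ifs at hle ⊢ <;> omega
  refine Matrix.det_zero_of_row_eq hab.ne ?_
  funext j
  simp only [Matrix.of_apply, heq]

/-- The initial condition. A nonzero Leibniz term needs `x ∘ σ ≤ Y`; equal sums force `x ∘ σ = Y`,
so `σ` is increasing and therefore the identity. -/
theorem pathDet_eq_ite {n : ℕ} (x Y : Fin n → ℤ) (hx : StrictAnti x) (hY : StrictAnti Y)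
    (h : ∑ i, Y i = ∑ i, x i) : pathDet x Y = if x = Y then 1 else 0 := by
  rw [pathDet, ← Matrix.det_transpose, Matrix.det_apply']
  have key : ∀ σ : Equiv.Perm (Fin n), ∏ i, recipFactorial (Y i - x (σ i)) ≠ 0 →
      σ = 1 ∧ x = Y := fun σ hσ => by
    have h1 : ∀ i, x (σ i) ≤ Y i := fun i => by
      by_contra hlt
      exact hσ (Finset.prod_eq_zero (Finset.mem_univ i) (recipFactorial_of_neg (by omega)))
    have h2 : ∀ i, x (σ i) = Y i := fun i =>
      (Finset.sum_eq_sum_iff_of_le fun i _ => h1 i).1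
        (by rw [h, Equiv.sum_comp σ x]) i (Finset.mem_univ i)
    have h3 : StrictMono σ := fun a b hab => by
      have h4 := hY hab
      rw [← h2, ← h2] at h4
      exact hx.lt_iff_gt.1 h4
    have h5 : σ = 1 := by
      have := Subsingleton.elim (h3.orderIsoOfSurjective σ σ.surjective) (OrderIso.refl (Fin n))
      ext i
      exact congrArg (fun f : Fin n ≃o Fin n => ((f i : Fin n) : ℕ)) this
    refine ⟨h5, funext fun i => ?_⟩
    simpa [h5] using h2 i
  rw [Finset.sum_eq_single (1 : Equiv.Perm (Fin n))]
  · simp only [Matrix.transpose_apply, Matrix.of_apply]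
    by_cases hxY : x = Y
    · subst hxY
      simp [recipFactorial]
    · rw [if_neg hxY]
      by_contra h0
      refine hxY (key 1 fun h1 => h0 ?_).2
      simp only [Equiv.Perm.coe_one, id] at h1 ⊢
      rw [h1, mul_zero]
  · intro σ _ hσ
    by_contra h0
    refine hσ (key σ fun h1 => h0 ?_).1
    simp only [Matrix.transpose_apply, Matrix.of_apply]
    rw [h1, mul_zero]
  · simp

/-! ### Steps in lifted coordinates and finiteness of the Green kernel -/

/-- The coordinates of a point of the chamber, as integers. -/
def Chamber.zcoord {n : ℕ} (x : Chamber n) : Fin n → ℤ := fun j => x.coord j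

theorem Chamber.strictAnti_zcoord {n : ℕ} (x : Chamber n) : StrictAnti x.zcoord := fun a b h => by
  simpa [Chamber.zcoord] using x.strictAnti h

theorem Chamber.sum_zcoord {n : ℕ} (x : Chamber n) : ∑ i, x.zcoord i = x.length := by
  simp [Chamber.zcoord, Chamber.length]

/-- A step is a unit step of `ℤⁿ` up to a diagonal translation `c`, which records the
renormalization of the last coordinate to zero. -/
theorem Chamber.point_sub_point_eq_stepVec_iff {n : ℕ} (y z : Chamber n) (i : Fin n) :
    y.point - z.point = stepVec i ↔
      ∃ c : ℤ, ∀ j, z.zcoord j + c = y.zcoord j - Pi.single (M := fun _ => ℤ) i 1 j := by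
  have hn : (n : ℝ) ≠ 0 := by exact_mod_cast (Nat.ne_of_gt i.pos)
  have hpt : y.point - z.point = stepVec i ↔ ∀ j,
      (y.coord j : ℝ) - (n : ℝ)⁻¹ * y.length - ((z.coord j : ℝ) - (n : ℝ)⁻¹ * z.length) =
        (if j = i then 1 else 0) - (n : ℝ)⁻¹ := by
    rw [PiLp.ext_iff]
    refine forall_congr' fun j => ?_
    rw [PiLp.sub_apply, Chamber.point_apply, Chamber.point_apply]
    have : stepVec i j = (if j = i then 1 else 0) - (n : ℝ)⁻¹ := by
      simp [stepVec, Pi.single_apply]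
    rw [this]
  rw [hpt]
  constructor
  · intro h
    refine ⟨y.coord i - 1 - z.coord i, fun j => ?_⟩
    have h1 := h j
    have h2 := h i
    simp only [if_true] at h2
    simp only [Chamber.zcoord, Pi.single_apply]
    have h3 : (z.coord j : ℝ) + (y.coord i - 1 - z.coord i) =
        y.coord j - (if j = i then 1 else 0) := by linarith
    split_ifs at h3 ⊢ <;> exact_mod_cast h3
  · rintro ⟨c, hc⟩
    have hsum := Finset.sum_congr rfl fun j (_ : j ∈ Finset.univ) => hc j
    rw [Finset.sum_add_distrib, Finset.sum_sub_distrib, Chamber.sum_zcoord, Chamber.sum_zcoord,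
      Finset.sum_pi_single'] at hsum
    simp only [Finset.sum_const, Finset.card_univ, Fintype.card_fin, nsmul_eq_mul,
      Finset.mem_univ, if_true] at hsum
    have hsum' : (z.length : ℝ) + n * c = y.length - 1 := by exact_mod_cast hsum
    intro j
    have h1 : (z.coord j : ℝ) + c = y.coord j - (if j = i then 1 else 0) := by
      have := hc j
      simp only [Chamber.zcoord, Pi.single_apply] at this
      split_ifs at this ⊢ <;> exact_mod_cast this
    have h2 : (n : ℝ)⁻¹ * z.length + c = (n : ℝ)⁻¹ * y.length - (n : ℝ)⁻¹ := by
      have := congrArg (fun s => (n : ℝ)⁻¹ * s) hsum'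
      simp only [mul_add, mul_sub, inv_mul_cancel_left₀ hn] at this
      linarith
    linarith

theorem Chamber.length_of_shift {n : ℕ} {y z : Chamber n} {i : Fin n} {c : ℤ}
    (hc : ∀ j, z.zcoord j + c = y.zcoord j - Pi.single (M := fun _ => ℤ) i 1 j) :
    (z.length : ℤ) + n * c = y.length - 1 := by
  have hsum := Finset.sum_congr rfl fun j (_ : j ∈ Finset.univ) => hc j
  rw [Finset.sum_add_distrib, Finset.sum_sub_distrib, Chamber.sum_zcoord, Chamber.sum_zcoord,
    Finset.sum_pi_single'] at hsum
  simpa using hsum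

theorem stepVec_injective {n : ℕ} : Function.Injective (stepVec (n := n)) := by
  intro i j h
  have h1 : EuclideanSpace.single i (1 : ℝ) = EuclideanSpace.single j 1 := by
    simpa [stepVec] using h
  by_contra hij
  have := congrArg (fun v : EuclideanSpace ℝ (Fin n) => v i) h1
  simp [hij] at this

-- The vectors `e_i` are distinct, so at most one direction contributes; this lets predecessors be
-- summed direction by direction.
open Classical in
theorem kernel_eq_sum {n : ℕ} (q : ℝ) (z y : Chamber n) :
    kernel q z y =
      ∑ i : Fin n, if y.point - z.point = stepVec i then ENNReal.ofReal (q / n) else 0 := by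
  rw [kernel]
  split_ifs with h
  · obtain ⟨i, hi⟩ := h
    rw [Finset.sum_eq_single i]
    · rw [if_pos hi]
    · intro j _ hj
      rw [if_neg]
      rw [hi]
      exact fun e => hj (stepVec_injective e.symm)
    · simp
  · push Not at h
    simp [h]

open Classical in
theorem tsum_mul_kernel {n : ℕ} (q : ℝ) (y : Chamber n) (f : Chamber n → ℝ≥0∞) :
    ∑' z, f z * kernel q z y = ∑ i : Fin n, ∑' z : Chamber n,
      if y.point - z.point = stepVec i then f z * ENNReal.ofReal (q / n) else 0 := by
  simp only [kernel_eq_sum, Finset.mul_sum, mul_ite, mul_zero]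
  exact Summable.tsum_finsetSum fun _ _ => ENNReal.summable

open Classical in
theorem tsum_step_of_eq {n : ℕ} {y z : Chamber n} {i : Fin n}
    (h : y.point - z.point = stepVec i) (f : Chamber n → ℝ≥0∞) :
    (∑' z : Chamber n, if y.point - z.point = stepVec i then f z else 0) = f z := by
  rw [tsum_eq_single z, if_pos h]
  intro w hw
  rw [if_neg]
  intro e
  exact hw (Chamber.point_injective (sub_right_injective (e.trans h.symm)))

/-- Each point has at most one predecessor per direction. Column sums are the relevant ones because
the iterates peel off the last step. -/
theorem tsum_kernel_le {n : ℕ} (hn : 0 < n) {q : ℝ} (y : Chamber n) :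
    ∑' z, kernel q z y ≤ ENNReal.ofReal q := by
  classical
  have h := tsum_mul_kernel q y (fun _ => 1)
  simp only [one_mul] at h
  rw [h]
  have h1 : ∀ i : Fin n, (∑' z : Chamber n,
      if y.point - z.point = stepVec i then ENNReal.ofReal (q / n) else 0) ≤
        ENNReal.ofReal (q / n) := fun i => by
    by_cases hz : ∃ z : Chamber n, y.point - z.point = stepVec i
    · obtain ⟨z, hz⟩ := hz
      rw [tsum_step_of_eq hz fun _ => ENNReal.ofReal (q / n)]
    · push Not at hz
      simp [hz]
  refine (Finset.sum_le_sum fun i _ => h1 i).trans ?_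
  have hn' : (n : ℝ) ≠ 0 := by exact_mod_cast hn.ne'
  rw [Finset.sum_const, Finset.card_univ, Fintype.card_fin, nsmul_eq_mul,
    ← ENNReal.ofReal_natCast, ← ENNReal.ofReal_mul (Nat.cast_nonneg n), mul_div_cancel₀ q hn']

theorem kernelPow_le {n : ℕ} (hn : 0 < n) {q : ℝ} (m : ℕ) (x y : Chamber n) :
    kernelPow q m x y ≤ ENNReal.ofReal q ^ m := by
  induction m generalizing y with
  | zero => simp only [kernelPow, pow_zero]; split_ifs <;> simp
  | succ m ih =>
    calc kernelPow q (m + 1) x y = ∑' z, kernelPow q m x z * kernel q z y := rfl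
      _ ≤ ∑' z, ENNReal.ofReal q ^ m * kernel q z y :=
        ENNReal.tsum_le_tsum fun z => mul_le_mul_left (ih z) _
      _ = ENNReal.ofReal q ^ m * ∑' z, kernel q z y := ENNReal.tsum_mul_left
      _ ≤ ENNReal.ofReal q ^ m * ENNReal.ofReal q := mul_le_mul_right (tsum_kernel_le hn y) _
      _ = _ := (pow_succ _ _).symm

theorem green_lt_top {n : ℕ} (hn : 0 < n) {q : ℝ} (hq1 : q < 1) (x y : Chamber n) :
    green q x y < ⊤ := by
  refine (ENNReal.tsum_le_tsum fun m => kernelPow_le hn m x y).trans_lt ?_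
  rw [ENNReal.tsum_geometric, ENNReal.inv_lt_top, tsub_pos_iff_lt]
  exact ENNReal.ofReal_lt_one.2 hq1

/-! ### The determinant formula and the series for the Green kernel -/

theorem Chamber.exists_shift_eq {n : ℕ} (Z : Fin n → ℤ) (hZ : StrictAnti Z) (i : Fin n) :
    ∃ (z : Chamber n) (c : ℤ), ∀ j, z.zcoord j + c = Z j := by
  have hlt : n - 1 < n := Nat.sub_lt i.pos Nat.one_pos
  set l : Fin n := ⟨n - 1, hlt⟩
  have hl : ∀ j, Z l ≤ Z j := fun j => hZ.antitone (Nat.le_sub_one_of_lt j.isLt)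
  refine ⟨⟨fun j => (Z j - Z l).toNat, fun a b hab => ?_, fun j hj => ?_⟩, Z l, fun j => ?_⟩
  · have h1 := hZ hab
    have h2 := hl b
    show (Z b - Z l).toNat < (Z a - Z l).toNat
    omega
  · have : j = l := Fin.ext (by simp only [l]; omega)
    simp [this]
  · have := hl j
    simp only [Chamber.zcoord]
    omega

/-- Every step raises the length by 1 modulo `n`. -/
theorem kernelPow_eq_zero {n : ℕ} (q : ℝ) (x : Chamber n) (m : ℕ) (y : Chamber n)
    (h : ∀ k : ℤ, (m : ℤ) + x.length ≠ y.length + n * k) : kernelPow q m x y = 0 := by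
  induction m generalizing y with
  | zero =>
    refine if_neg ?_
    rintro rfl
    exact h 0 (by simp)
  | succ m ih =>
    rw [kernelPow, ENNReal.tsum_eq_zero]
    intro z
    by_cases hz : ∃ i : Fin n, y.point - z.point = stepVec i
    · obtain ⟨i, hi⟩ := hz
      obtain ⟨c, hc⟩ := (Chamber.point_sub_point_eq_stepVec_iff y z i).1 hi
      have hl := Chamber.length_of_shift hc
      rw [ih z, zero_mul]
      intro k hk
      refine h (k - c) ?_
      push_cast
      linarith
    · rw [kernel, if_neg hz, mul_zero]

/-- The determinant formula for the iterates of the kernel (Karlin-McGregor). -/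
theorem kernelPow_eq {n : ℕ} {q : ℝ} (hq : 0 < q) (x : Chamber n) (m : ℕ) (y : Chamber n) (k : ℤ)
    (h : (m : ℤ) + x.length = y.length + n * k) :
    0 ≤ pathDet x.zcoord (fun i => y.zcoord i + k) ∧ kernelPow q m x y =
      ENNReal.ofReal ((q / n) ^ m * m ! * pathDet x.zcoord (fun i => y.zcoord i + k)) := by
  classical
  have hanti : ∀ (y : Chamber n) (k : ℤ), StrictAnti fun i => y.zcoord i + k :=
    fun y k a b hab => add_lt_add_left (y.strictAnti_zcoord hab) k
  have hsum : ∀ (y : Chamber n) (k : ℤ), ∑ i, (y.zcoord i + k) = y.length + n * k := fun y k => by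
    rw [Finset.sum_add_distrib, y.sum_zcoord]; simp
  induction m generalizing y k with
  | zero =>
    have hD := pathDet_eq_ite x.zcoord _ x.strictAnti_zcoord (hanti y k)
      (by rw [hsum, x.sum_zcoord]; simpa using h.symm)
    have hiff : x = y ↔ x.zcoord = fun i => y.zcoord i + k := by
      constructor
      · rintro rfl
        have hk : (n : ℤ) * k = 0 := by simpa using h
        rcases mul_eq_zero.1 hk with h0 | h0
        · have : n = 0 := by exact_mod_cast h0
          subst this
          exact funext fun i => i.elim0
        · simp [h0]
      · intro e
        ext j
        have hn : n - 1 < n := Nat.sub_lt j.pos Nat.one_pos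
        have h1 := congrFun e ⟨n - 1, hn⟩
        have h2 := congrFun e j
        simp only [Chamber.zcoord] at h1 h2
        rw [x.last_eq_zero _ (Nat.sub_add_cancel j.pos),
          y.last_eq_zero _ (Nat.sub_add_cancel j.pos)] at h1
        omega
    rw [hD]
    refine ⟨by split_ifs <;> simp, ?_⟩
    simp only [kernelPow, hiff]
    split_ifs <;> simp
  | succ m ih =>
    set Y : Fin n → ℤ := fun i => y.zcoord i + k with hYdef
    -- The contribution of a last step `e_i`. If `Y - e_i` is outside the chamber, there is no
    -- predecessor and the determinant vanishes too.
    have hstep : ∀ i : Fin n, 0 ≤ pathDet x.zcoord (Y - Pi.single i 1) ∧ (∑' z : Chamber n,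
        if y.point - z.point = stepVec i then kernelPow q m x z * ENNReal.ofReal (q / n) else 0) =
        ENNReal.ofReal ((q / n) ^ (m + 1) * m ! * pathDet x.zcoord (Y - Pi.single i 1)) := by
      intro i
      by_cases hZ : StrictAnti (Y - Pi.single i 1)
      · have hZ' : StrictAnti (y.zcoord - Pi.single i 1) := fun a b hab => by
          have := hZ hab
          simp only [hYdef, Pi.sub_apply] at this ⊢
          omega
        obtain ⟨z, c, hc⟩ := Chamber.exists_shift_eq _ hZ' i
        have hl := Chamber.length_of_shift hc
        have hz := (Chamber.point_sub_point_eq_stepVec_iff y z i).2 ⟨c, hc⟩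
        obtain ⟨h0, h1⟩ := ih z (c + k) (by push_cast at h; linarith)
        have hYZ : (fun j => z.zcoord j + (c + k)) = Y - Pi.single i 1 := funext fun j => by
          have := hc j
          simp only [hYdef, Pi.sub_apply] at this ⊢
          omega
        rw [hYZ] at h0 h1
        refine ⟨h0, ?_⟩
        rw [tsum_step_of_eq hz fun z => kernelPow q m x z * ENNReal.ofReal (q / n), h1,
          ← ENNReal.ofReal_mul (by positivity)]
        congr 1
        ring
      · rw [pathDet_eq_zero_of_not_strictAnti x.zcoord Y (hanti y k) i hZ]
        refine ⟨le_rfl, ?_⟩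
        rw [mul_zero, ENNReal.ofReal_zero, ENNReal.tsum_eq_zero]
        intro z
        rw [if_neg]
        intro hz
        obtain ⟨c, hc⟩ := (Chamber.point_sub_point_eq_stepVec_iff y z i).1 hz
        refine hZ fun a b hab => ?_
        have h1 := hc a
        have h2 := hc b
        have h3 := z.strictAnti_zcoord hab
        simp only [hYdef, Pi.sub_apply] at h1 h2 ⊢
        omega
    have hrec := sum_pathDet_sub_single x.zcoord Y
    have hm : ∑ i, Y i - ∑ i, x.zcoord i = m + 1 := by
      rw [hYdef, hsum, x.sum_zcoord]
      push_cast at h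
      linarith
    rw [hm] at hrec
    push_cast at hrec
    have hm1 : (0 : ℝ) < m + 1 := by positivity
    -- Nonnegativity travels with the induction because `ENNReal.ofReal` truncates, and is additive
    -- only on nonnegative terms.
    have h0 : 0 ≤ pathDet x.zcoord Y := by
      have : 0 ≤ ((m : ℝ) + 1) * pathDet x.zcoord Y := by
        rw [← hrec]
        exact Finset.sum_nonneg fun i _ => (hstep i).1
      exact nonneg_of_mul_nonneg_right this hm1
    refine ⟨h0, ?_⟩
    show ∑' z, kernelPow q m x z * kernel q z y = _
    rw [tsum_mul_kernel, Finset.sum_congr rfl fun i _ => (hstep i).2,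
      ← ENNReal.ofReal_sum_of_nonneg fun i _ =>
        mul_nonneg (by positivity) (hstep i).1, ← Finset.mul_sum, hrec, Nat.factorial_succ]
    congr 1
    push_cast
    ring

/-- The weight of the paths from `x` to the lift `y + (k, …, k)` of `y`. -/
noncomputable def greenTerm {n : ℕ} (q : ℝ) (x y : Chamber n) (k : ℕ) : ℝ :=
  (q / n) ^ (y.length + n * k - x.length) * (y.length + n * k - x.length)! *
    pathDet x.zcoord fun i => y.zcoord i + k

theorem greenTerm_nonneg {n : ℕ} {q : ℝ} (hq : 0 < q) {x y : Chamber n}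
    (h : x.length ≤ y.length) (k : ℕ) : 0 ≤ greenTerm q x y k := by
  have := (kernelPow_eq hq x (y.length + n * k - x.length) y k (by
    rw [Nat.cast_sub (by nlinarith)]; push_cast; ring)).1
  rw [greenTerm]
  positivity

/-- The last coordinate of the lift is `k`, so the last row consists of reciprocal factorials of
negative integers. -/
theorem pathDet_eq_zero_of_neg {n : ℕ} (hn : 0 < n) (x y : Chamber n) {k : ℤ} (hk : k < 0) :
    pathDet x.zcoord (fun i => y.zcoord i + k) = 0 := by
  have hlt : n - 1 < n := Nat.sub_lt hn Nat.one_pos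
  refine Matrix.det_eq_zero_of_row_eq_zero ⟨n - 1, hlt⟩ fun j => recipFactorial_of_neg ?_
  have h1 := y.last_eq_zero ⟨n - 1, hlt⟩ (Nat.sub_add_cancel hn)
  simp only [Chamber.zcoord, h1]
  omega

theorem green_eq_tsum {n : ℕ} (hn : 0 < n) {q : ℝ} (hq : 0 < q) {x y : Chamber n}
    (h : x.length ≤ y.length) : green q x y = ∑' k : ℕ, ENNReal.ofReal (greenTerm q x y k) := by
  -- Since `|x| ≤ |y|`, the subtraction does not truncate; these are the only times that can
  -- contribute.
  have hinj : Function.Injective fun k : ℕ => y.length + n * k - x.length := fun a b hab => by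
    have h1 : y.length + n * a - x.length = y.length + n * b - x.length := hab
    have h2 : n * a = n * b := by omega
    exact Nat.eq_of_mul_eq_mul_left hn h2
  have hsupp : Function.support (fun m => kernelPow q m x y) ⊆
      Set.range fun k : ℕ => y.length + n * k - x.length := by
    intro m hm
    by_contra hr
    refine hm ?_
    by_cases hk : ∃ k : ℤ, (m : ℤ) + x.length = y.length + n * k
    · obtain ⟨k, hk⟩ := hk
      have hk0 : k < 0 := by
        by_contra hk0
        obtain ⟨k, rfl⟩ := Int.eq_ofNat_of_zero_le (not_lt.1 hk0)
        refine hr ⟨k, ?_⟩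
        have : m + x.length = y.length + n * k := by exact_mod_cast hk
        show y.length + n * k - x.length = m
        omega
      show kernelPow q m x y = 0
      rw [(kernelPow_eq hq x m y k hk).2, pathDet_eq_zero_of_neg hn x y hk0]
      simp
    · push Not at hk
      exact kernelPow_eq_zero q x m y hk
  rw [green, ← hinj.tsum_eq hsupp]
  refine tsum_congr fun k => ?_
  exact (kernelPow_eq hq x (y.length + n * k - x.length) y k (by
    rw [Nat.cast_sub (by nlinarith)]; push_cast; ring)).2

theorem hasSum_greenTerm {n : ℕ} (hn : 0 < n) {q : ℝ} (hq : 0 < q) (hq1 : q < 1) {x y : Chamber n}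
    (h : x.length ≤ y.length) : HasSum (greenTerm q x y) (green q x y).toReal := by
  have h1 := green_eq_tsum hn hq h
  have h2 := (green_lt_top hn hq1 x y).ne
  rw [h1] at h2
  have h3 := ENNReal.hasSum_toReal h2
  rw [← ENNReal.tsum_toReal_eq (fun _ => ENNReal.ofReal_ne_top), ← h1] at h3
  simpa only [ENNReal.toReal_ofReal (greenTerm_nonneg hq h _)] using h3

end WeylWalk

namespace WeylWalk

open MvPolynomial

/-! ### Factorial Schur functions -/

/-- The monic polynomial `∏_{l < m} (X - l h)`. -/
noncomputable def fallingPoly (m : ℕ) (h : ℝ) : Polynomial ℝ :=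
  ∏ l ∈ Finset.range m, (Polynomial.X - Polynomial.C (l * h))

theorem fallingPoly_monic (m : ℕ) (h : ℝ) : (fallingPoly m h).Monic :=
  Polynomial.monic_prod_of_monic _ _ fun _ _ => Polynomial.monic_X_sub_C _

theorem natDegree_fallingPoly (m : ℕ) (h : ℝ) : (fallingPoly m h).natDegree = m := by
  rw [fallingPoly, Polynomial.natDegree_prod_of_monic _ _ fun _ _ => Polynomial.monic_X_sub_C _]
  simp only [Polynomial.natDegree_X_sub_C, Finset.sum_const, Finset.card_range, smul_eq_mul, mul_one]

theorem fallingPoly_zero_right (m : ℕ) : fallingPoly m 0 = Polynomial.X ^ m := by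
  simp [fallingPoly]

theorem continuous_coeff_fallingPoly (m k : ℕ) :
    Continuous fun h => (fallingPoly m h).coeff k := by
  induction m generalizing k with
  | zero => simpa [fallingPoly] using continuous_const
  | succ m ih =>
    have hs : ∀ h, fallingPoly (m + 1) h =
        fallingPoly m h * (Polynomial.X - Polynomial.C (m * h)) := fun h => by
      rw [fallingPoly, Finset.prod_range_succ, ← fallingPoly]
    simp only [hs]
    cases k with
    | zero =>
      simp only [Polynomial.mul_coeff_zero, Polynomial.coeff_sub, Polynomial.coeff_X_zero,
        Polynomial.coeff_C_zero]
      exact (ih 0).mul (by fun_prop)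
    | succ k =>
      simp only [Polynomial.coeff_mul_X_sub_C]
      exact (ih k).sub ((ih (k + 1)).mul (by fun_prop))

/-- Rescaling by `c` turns the unit spacing of a falling factorial into spacing `c`; as `c → 0` only
a power remains. -/
theorem eval_fallingPoly_natCast (m Y : ℕ) (c : ℝ) :
    (fallingPoly m c).eval (c * Y) = c ^ m * (Y.descFactorial m : ℝ) := by
  rw [← descPochhammer_eval_eq_descFactorial, descPochhammer_eval_eq_prod_range, fallingPoly,
    Polynomial.eval_prod, Finset.pow_eq_prod_const c m, ← Finset.prod_mul_distrib]
  refine Finset.prod_congr rfl fun l _ => ?_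
  simp
  ring

/-- The quotient of an alternant by the Vandermonde product. -/
noncomputable def alternantQuot {n : ℕ} (m : Fin n → ℕ) : MvPolynomial (Fin n) ℝ :=
  (vandermondePoly_dvd_alternant m).choose

theorem vandermondePoly_mul_alternantQuot {n : ℕ} (m : Fin n → ℕ) :
    vandermondePoly n * alternantQuot m = alternant m :=
  (vandermondePoly_dvd_alternant m).choose_spec.symm

theorem alternantQuot_coord {n : ℕ} (x : Chamber n) : alternantQuot x.coord = schur x.subRho := by
  have h : (fun j => x.subRho j + (n - 1 - (j : ℕ))) = x.coord := funext fun j => by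
    have := x.rho_le j
    exact Nat.sub_add_cancel this
  simp only [schur, h, alternantQuot]

/-- The factorial Schur functions, with the shift `h` as a parameter. -/
noncomputable def shiftedSchur {n : ℕ} (x : Fin n → ℕ) (v : Fin n → ℝ) (h : ℝ) : ℝ :=
  ∑ κ ∈ Fintype.piFinset fun j => Finset.range (x j + 1),
    (∏ j, (fallingPoly (x j) h).coeff (κ j)) * eval v (alternantQuot κ)

theorem continuous_shiftedSchur {n : ℕ} (x : Fin n → ℕ) :
    Continuous fun p : (Fin n → ℝ) × ℝ => shiftedSchur x p.1 p.2 := by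
  refine continuous_finsetSum _ fun κ _ => Continuous.mul ?_ ?_
  · exact continuous_finsetProd _ fun j _ =>
      (continuous_coeff_fallingPoly (x j) (κ j)).comp continuous_snd
  · exact (MvPolynomial.continuous_eval _).comp continuous_fst

/-- At `h = 0` the falling polynomials are monomials, so only `κ = x` survives. -/
theorem shiftedSchur_zero {n : ℕ} (x : Fin n → ℕ) (v : Fin n → ℝ) :
    shiftedSchur x v 0 = eval v (alternantQuot x) := by
  rw [shiftedSchur, Finset.sum_eq_single x]
  · simp [fallingPoly_zero_right]
  · intro κ _ hκ
    obtain ⟨j, hj⟩ := Function.ne_iff.1 hκ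
    rw [Finset.prod_eq_zero (Finset.mem_univ j), zero_mul]
    rw [fallingPoly_zero_right, Polynomial.coeff_X_pow, if_neg hj]
  · intro h
    exact absurd (Fintype.mem_piFinset.2 fun j => by simp) h

/-- Expand every column into monomials; each resulting alternant is divisible by the Vandermonde
product. Dividing at the level of polynomials keeps the quotient continuous where coordinates of the
limit direction coincide. -/
theorem det_eval_fallingPoly {n : ℕ} (x : Fin n → ℕ) (v : Fin n → ℝ) (h : ℝ) :
    (Matrix.of fun i j => (fallingPoly (x j) h).eval (v i)).det =
      eval v (vandermondePoly n) * shiftedSchur x v h := by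
  have hq : ∀ κ : Fin n → ℕ, eval v (vandermondePoly n) * eval v (alternantQuot κ) =
      ∑ σ : Equiv.Perm (Fin n), (Equiv.Perm.sign σ : ℝ) * ∏ j, v (σ j) ^ κ j := fun κ => by
    rw [← map_mul, vandermondePoly_mul_alternantQuot, alternant, RingHom.map_det,
      Matrix.det_apply']
    simp
  rw [Matrix.det_apply', shiftedSchur, Finset.mul_sum]
  have hp : ∀ σ : Equiv.Perm (Fin n),
      ∏ j, (Matrix.of fun i j => (fallingPoly (x j) h).eval (v i)) (σ j) j =
      ∑ κ ∈ Fintype.piFinset fun j => Finset.range (x j + 1),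
        ∏ j, ((fallingPoly (x j) h).coeff (κ j) * v (σ j) ^ κ j) := fun σ => by
    refine Eq.trans ?_ (Finset.prod_univ_sum _
      fun j k => (fallingPoly (x j) h).coeff k * v (σ j) ^ k)
    refine Finset.prod_congr rfl fun j _ => ?_
    rw [Matrix.of_apply, Polynomial.eval_eq_sum_range, natDegree_fallingPoly]
  simp only [hp, Finset.mul_sum]
  rw [Finset.sum_comm]
  refine Finset.sum_congr rfl fun κ _ => ?_
  rw [mul_left_comm, hq, Finset.mul_sum]
  refine Finset.sum_congr rfl fun σ _ => ?_
  rw [Finset.prod_mul_distrib]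
  ring

theorem eval_vandermondePoly {n : ℕ} (v : Fin n → ℝ) :
    eval v (vandermondePoly n) = ∏ p : Fin n × Fin n with p.1 < p.2, (v p.1 - v p.2) := by
  simp [vandermondePoly]

/-- The columns are monic polynomials of degrees `n - 1, …, 0`, so the determinant is a Vandermonde
determinant after reversing rows and columns. -/
theorem det_eval_fallingPoly_rho {n : ℕ} (v : Fin n → ℝ) (h : ℝ) :
    (Matrix.of fun i j => (fallingPoly ((rho n).coord j) h).eval (v i)).det =
      eval v (vandermondePoly n) := by
  have h1 := Matrix.det_eval_matrixOfPolynomials_eq_det_vandermonde (v ∘ Fin.rev)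
    (fun i => fallingPoly i h) (fun i => natDegree_fallingPoly i h) (fun i => fallingPoly_monic i h)
  rw [← Matrix.det_submatrix_equiv_self Fin.revPerm]
  have h2 : (Matrix.of fun i j => (fallingPoly ((rho n).coord j) h).eval (v i)).submatrix
      Fin.revPerm Fin.revPerm =
      Matrix.of fun i j : Fin n => (fallingPoly j h).eval ((v ∘ Fin.rev) i) := by
    ext i j
    simp only [Matrix.submatrix_apply, Matrix.of_apply, Fin.revPerm_apply, Function.comp]
    have : (rho n).coord j.rev = j := by
      show n - 1 - (j.rev : ℕ) = j
      rw [Fin.val_rev]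
      omega
    rw [this]
  rw [h2, ← h1, Matrix.det_vandermonde, eval_vandermondePoly, Finset.prod_sigma']
  refine Finset.prod_bij' (fun p _ => (p.2.rev, p.1.rev)) (fun p _ => ⟨p.2.rev, p.1.rev⟩)
    ?_ ?_ ?_ ?_ ?_ <;> simp

/-- Write `1 / (Y - x)!` as the falling factorial of `Y` of order `x` divided by `Y!`; both sides
vanish when `Y < x`. -/
theorem pathDet_natCast {n : ℕ} (x Y : Fin n → ℕ) (c : ℝ) :
    c ^ (∑ j, x j) * pathDet (fun j => (x j : ℤ)) (fun i => (Y i : ℤ)) =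
      (∏ i, ((Y i).factorial : ℝ)⁻¹) *
        (Matrix.of fun i j => (fallingPoly (x j) c).eval (c * Y i)).det := by
  have hrf : ∀ a b : ℕ, recipFactorial ((a : ℤ) - b) =
      (a.factorial : ℝ)⁻¹ * (a.descFactorial b : ℝ) := fun a b => by
    rcases le_or_gt b a with h | h
    · rw [← Nat.cast_sub h, recipFactorial_natCast, ← Nat.factorial_mul_descFactorial h]
      have h1 : ((a - b).factorial : ℝ) ≠ 0 := by exact_mod_cast Nat.factorial_ne_zero _
      have h2 : (a.descFactorial b : ℝ) ≠ 0 := by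
        exact_mod_cast fun e => (Nat.descFactorial_eq_zero_iff_lt.1 e).not_ge h
      push_cast
      field_simp
    · rw [recipFactorial_of_neg (by omega), Nat.descFactorial_of_lt h]
      simp
  simp only [pathDet, hrf, eval_fallingPoly_natCast]
  have h1 := Matrix.det_mul_column (fun i => ((Y i).factorial : ℝ)⁻¹)
    (Matrix.of fun i j => ((Y i).descFactorial (x j) : ℝ))
  have h2 := Matrix.det_mul_row (fun j => c ^ x j)
    (Matrix.of fun i j => ((Y i).descFactorial (x j) : ℝ))
  simp only [Matrix.of_apply] at h1 h2
  rw [h1, h2, Finset.prod_pow_eq_pow_sum]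
  ring

/-- The lift `y + (k, …, k)` of a point of the chamber. -/
def Chamber.lift {n : ℕ} (y : Chamber n) (k : ℕ) : Fin n → ℕ := fun i => y.coord i + k

theorem pathDet_lift {n : ℕ} (x y : Chamber n) (k : ℕ) (c : ℝ) :
    c ^ x.length * pathDet x.zcoord (fun i => y.zcoord i + k) =
      (∏ i, ((y.lift k i).factorial : ℝ)⁻¹) *
        (eval (fun i => c * y.lift k i) (vandermondePoly n) *
          shiftedSchur x.coord (fun i => c * y.lift k i) c) := by
  rw [← det_eval_fallingPoly, ← pathDet_natCast]
  simp only [Chamber.length, Chamber.lift, Nat.cast_add]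
  rfl

theorem pathDet_rho_lift {n : ℕ} (y : Chamber n) (k : ℕ) (c : ℝ) :
    c ^ (rho n).length * pathDet (rho n).zcoord (fun i => y.zcoord i + k) =
      (∏ i, ((y.lift k i).factorial : ℝ)⁻¹) *
        eval (fun i => c * y.lift k i) (vandermondePoly n) := by
  rw [← det_eval_fallingPoly_rho _ c, ← pathDet_natCast]
  simp only [Chamber.length, Chamber.lift, Nat.cast_add]
  rfl

/-- The Vandermonde product is invariant under translation, so `k` enters only through the
factorials. -/
theorem pathDet_rho_eq {n : ℕ} (y : Chamber n) (k : ℕ) :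
    pathDet (rho n).zcoord (fun i => y.zcoord i + k) =
      (∏ i, ((y.lift k i).factorial : ℝ)⁻¹) *
        eval (fun i => (y.coord i : ℝ)) (vandermondePoly n) := by
  have h := pathDet_rho_lift y k 1
  rw [one_pow, one_mul] at h
  rw [h, eval_vandermondePoly, eval_vandermondePoly]
  simp [Chamber.lift]

theorem eval_vandermondePoly_pos {n : ℕ} (y : Chamber n) :
    0 < eval (fun i => (y.coord i : ℝ)) (vandermondePoly n) := by
  rw [eval_vandermondePoly]
  refine Finset.prod_pos fun p hp => ?_
  have := y.strictAnti (Finset.mem_filter.1 hp).2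
  exact sub_pos.2 (by exact_mod_cast this)

end WeylWalk

namespace WeylWalk

/-! ### Concentration of weighted averages -/

/-- Moving the index back by one gains a factor `c` and changes `u` by at most `η`; this can be done
`M` times. Index 0 is outside the region because `u₀ ≤ u 0`, so no boundary term appears. -/
theorem tsum_indicator_le_pow_of_decay {w u : ℕ → ℝ} {u₀ ε η c : ℝ} (hw : Summable w)
    (hw0 : ∀ k, 0 ≤ w k) (hε : 0 < ε) (hη : 0 ≤ η) (hc : 0 ≤ c) (hu₀ : u₀ ≤ u 0)
    (hstep : ∀ k, |u (k + 1) - u k| ≤ η) (h : ∀ k, u k ≤ u₀ - ε → w (k + 1) ≤ c * w k) (M : ℕ) :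
    ∑' k, Set.indicator {k | u k ≤ u₀ - (ε + M * η)} w k ≤ c ^ M * ∑' k, w k := by
  induction M with
  | zero =>
    rw [pow_zero, one_mul]
    exact (hw.indicator _).tsum_le_tsum (fun k => Set.indicator_le_self' (fun _ _ => hw0 _) k) hw
  | succ M ih =>
    have hs := hw.indicator {k | u k ≤ u₀ - (ε + (M + 1 : ℕ) * η)}
    have hs' := hw.indicator {k | u k ≤ u₀ - (ε + M * η)}
    rw [hs.tsum_eq_zero_add, Set.indicator_of_notMem, zero_add, pow_succ', mul_assoc]
    · refine le_trans ?_ (mul_le_mul_of_nonneg_left ih hc)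
      rw [← tsum_mul_left]
      refine ((summable_nat_add_iff 1).2 hs).tsum_le_tsum (fun k => ?_) (hs'.mul_left c)
      by_cases hk : u (k + 1) ≤ u₀ - (ε + (M + 1 : ℕ) * η)
      · have h1 := (abs_le.1 (hstep k)).1
        push_cast at hk
        have h2 : u k ≤ u₀ - (ε + M * η) := by linarith
        have h3 : 0 ≤ M * η := by positivity
        rw [Set.indicator_of_mem (show k + 1 ∈ _ by simpa using hk), Set.indicator_of_mem
          (show k ∈ {k | u k ≤ u₀ - (ε + M * η)} from h2)]
        exact h k (by linarith)
      · rw [Set.indicator_of_notMem (show k + 1 ∉ _ from hk)]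
        exact mul_nonneg hc (Set.indicator_nonneg (fun _ _ => hw0 _) _)
    · intro h0
      have h1 : u 0 ≤ u₀ - (ε + (M + 1 : ℕ) * η) := h0
      have : 0 ≤ ((M + 1 : ℕ) : ℝ) * η := by positivity
      linarith

/-- The same argument with the index moved forward; the extra term at 0 is nonnegative and is
dropped. -/
theorem tsum_indicator_le_pow_of_growth {w u : ℕ → ℝ} {u₀ ε η c : ℝ} (hw : Summable w)
    (hw0 : ∀ k, 0 ≤ w k) (hη : 0 ≤ η) (hc : 0 ≤ c)
    (hstep : ∀ k, |u (k + 1) - u k| ≤ η) (h : ∀ k, u₀ + ε ≤ u k → w k ≤ c * w (k + 1)) (M : ℕ) :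
    ∑' k, Set.indicator {k | u₀ + (ε + M * η) ≤ u k} w k ≤ c ^ M * ∑' k, w k := by
  induction M with
  | zero =>
    rw [pow_zero, one_mul]
    exact (hw.indicator _).tsum_le_tsum (fun k => Set.indicator_le_self' (fun _ _ => hw0 _) k) hw
  | succ M ih =>
    have hs := hw.indicator {k | u₀ + (ε + (M + 1 : ℕ) * η) ≤ u k}
    have hs' := hw.indicator {k | u₀ + (ε + M * η) ≤ u k}
    rw [pow_succ', mul_assoc]
    refine le_trans ?_ (mul_le_mul_of_nonneg_left ih hc)
    rw [hs'.tsum_eq_zero_add]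
    refine le_trans ?_ (mul_le_mul_of_nonneg_left (le_add_of_nonneg_left
      (Set.indicator_nonneg (fun _ _ => hw0 _) _)) hc)
    rw [← tsum_mul_left]
    refine hs.tsum_le_tsum (fun k => ?_) (((summable_nat_add_iff 1).2 hs').mul_left c)
    by_cases hk : u₀ + (ε + (M + 1 : ℕ) * η) ≤ u k
    · have h1 := (abs_le.1 (hstep k)).1
      push_cast at hk
      have h2 : u₀ + (ε + M * η) ≤ u (k + 1) := by linarith
      have h3 : 0 ≤ M * η := by positivity
      rw [Set.indicator_of_mem (show k ∈ _ by simpa using hk), Set.indicator_of_mem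
        (show k + 1 ∈ {k | u₀ + (ε + M * η) ≤ u k} from h2)]
      exact h k (by linarith)
    · rw [Set.indicator_of_notMem (show k ∉ _ from hk)]
      exact mul_nonneg hc (Set.indicator_nonneg (fun _ _ => hw0 _) _)

/-- If the weights `w d` grow geometrically where `u d > u₀` and decay geometrically where
`u d < u₀`, then the averages of `g d` with these weights converge to the value of `g d` near
`u₀`. -/
theorem tendsto_weighted_average {w u g : ℕ → ℕ → ℝ} {u₀ L B : ℝ}
    (hw : ∀ᶠ d in atTop, Summable (w d)) (hw0 : ∀ᶠ d in atTop, ∀ k, 0 ≤ w d k)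
    (hpos : ∀ᶠ d in atTop, 0 < ∑' k, w d k) (hu₀ : ∀ᶠ d in atTop, u₀ ≤ u d 0)
    (hstep : ∀ η > 0, ∀ᶠ d in atTop, ∀ k, |u d (k + 1) - u d k| ≤ η)
    (hdecay : ∀ ε > 0, ∃ c, 0 ≤ c ∧ c < 1 ∧
      ∀ᶠ d in atTop, ∀ k, u d k ≤ u₀ - ε → w d (k + 1) ≤ c * w d k)
    (hgrowth : ∀ ε > 0, ∃ c, 0 ≤ c ∧ c < 1 ∧
      ∀ᶠ d in atTop, ∀ k, u₀ + ε ≤ u d k → w d k ≤ c * w d (k + 1))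
    (hB : ∀ᶠ d in atTop, ∀ k, |g d k| ≤ B)
    (hL : ∀ δ > 0, ∃ ε > 0, ∀ᶠ d in atTop, ∀ k, |u d k - u₀| < ε → |g d k - L| ≤ δ) :
    Tendsto (fun d => (∑' k, w d k * g d k) / ∑' k, w d k) atTop (𝓝 L) := by
  rw [Metric.tendsto_nhds]
  intro δ hδ
  obtain ⟨ε, hε, hL⟩ := hL (δ / 3) (by positivity)
  obtain ⟨c₁, hc₁, hc₁', hdecay⟩ := hdecay (ε / 2) (by positivity)
  obtain ⟨c₂, hc₂, hc₂', hgrowth⟩ := hgrowth (ε / 2) (by positivity)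
  have hB0 : 0 ≤ B := by
    obtain ⟨d, hd⟩ := hB.exists
    exact (abs_nonneg _).trans (hd 0)
  set C := B + |L| with hC
  have hC0 : 0 ≤ C := by positivity
  obtain ⟨M, hM, hM1, hM2⟩ : ∃ M : ℕ, 1 ≤ M ∧ C * c₁ ^ M < δ / 4 ∧ C * c₂ ^ M < δ / 4 := by
    have h1 := (tendsto_pow_atTop_nhds_zero_of_lt_one hc₁ hc₁').const_mul C
    have h2 := (tendsto_pow_atTop_nhds_zero_of_lt_one hc₂ hc₂').const_mul C
    rw [mul_zero] at h1 h2
    have hδ4 : 0 < δ / 4 := by positivity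
    exact ((eventually_ge_atTop 1).and ((h1.eventually_lt_const hδ4).and
      (h2.eventually_lt_const hδ4))).exists
  have hM0 : (0 : ℝ) < M := by exact_mod_cast hM
  -- With this step bound, `M` moves use up exactly the second half of `ε`. The total error is then
  -- below `δ/3 + δ/4 + δ/4` times the mass.
  have hη : 0 < ε / (2 * M) := by positivity
  filter_upwards [hw, hw0, hpos, hu₀, hstep _ hη, hdecay, hgrowth, hB, hL] with d hw hw0 hpos hu₀
    hstep hdecay hgrowth hB hL
  have hMη : ε / 2 + M * (ε / (2 * M)) = ε := by field_simp; ring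
  have t1 := tsum_indicator_le_pow_of_decay hw hw0 (by positivity) hη.le hc₁ hu₀ hstep hdecay M
  have t2 := tsum_indicator_le_pow_of_growth hw hw0 hη.le hc₂ hstep hgrowth M
  rw [hMη] at t1 t2
  have s1 := hw.indicator {k | u d k ≤ u₀ - ε}
  have s2 := hw.indicator {k | u₀ + ε ≤ u d k}
  have hsg : Summable fun k => w d k * g d k :=
    Summable.of_norm_bounded (hw.mul_right B) fun k => by
      rw [norm_mul, Real.norm_of_nonneg (hw0 k)]
      exact mul_le_mul_of_nonneg_left (hB k) (hw0 k)
  have hbound : ∀ k, ‖w d k * (g d k - L)‖ ≤ w d k * (δ / 3) +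
      C * ({k | u d k ≤ u₀ - ε}.indicator (w d) k + {k | u₀ + ε ≤ u d k}.indicator (w d) k) := by
    intro k
    have i1 : 0 ≤ {k | u d k ≤ u₀ - ε}.indicator (w d) k := Set.indicator_nonneg (fun _ _ => hw0 _) _
    have i2 : 0 ≤ {k | u₀ + ε ≤ u d k}.indicator (w d) k := Set.indicator_nonneg (fun _ _ => hw0 _) _
    have hg : |g d k - L| ≤ C := (abs_sub _ _).trans (by rw [hC]; gcongr; exact hB k)
    rw [norm_mul, Real.norm_of_nonneg (hw0 k), Real.norm_eq_abs]
    have hwδ : 0 ≤ w d k * (δ / 3) := mul_nonneg (hw0 k) (by positivity)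
    by_cases h1 : u d k ≤ u₀ - ε
    · rw [Set.indicator_of_mem (show k ∈ {k | u d k ≤ u₀ - ε} from h1)]
      have := mul_le_mul_of_nonneg_left hg (hw0 k)
      have := mul_nonneg hC0 i2
      nlinarith
    · by_cases h2 : u₀ + ε ≤ u d k
      · rw [Set.indicator_of_mem (show k ∈ {k | u₀ + ε ≤ u d k} from h2)]
        have := mul_le_mul_of_nonneg_left hg (hw0 k)
        have := mul_nonneg hC0 i1
        nlinarith
      · push Not at h1 h2
        have h3 := hL k (abs_lt.2 ⟨by linarith, by linarith⟩)
        have := mul_le_mul_of_nonneg_left h3 (hw0 k)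
        have := mul_nonneg hC0 (add_nonneg i1 i2)
        linarith
  have hsb : HasSum (fun k => w d k * (δ / 3) +
      C * ({k | u d k ≤ u₀ - ε}.indicator (w d) k + {k | u₀ + ε ≤ u d k}.indicator (w d) k))
      ((∑' k, w d k) * (δ / 3) + C * (∑' k, {k | u d k ≤ u₀ - ε}.indicator (w d) k +
        ∑' k, {k | u₀ + ε ≤ u d k}.indicator (w d) k)) :=
    (hw.hasSum.mul_right _).add ((s1.hasSum.add s2.hasSum).mul_left C)
  have hdiff : (∑' k, w d k * g d k) / (∑' k, w d k) - L =
      (∑' k, w d k * (g d k - L)) / ∑' k, w d k := by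
    simp only [mul_sub]
    rw [hsg.tsum_sub (hw.mul_right L), tsum_mul_right]
    field_simp
  rw [Real.dist_eq, hdiff, abs_div, abs_of_pos hpos, div_lt_iff₀ hpos, ← Real.norm_eq_abs]
  refine (tsum_of_norm_bounded hsb hbound).trans_lt ?_
  have e1 := mul_le_mul_of_nonneg_left t1 hC0
  have e2 := mul_le_mul_of_nonneg_left t2 hC0
  have e3 := mul_lt_mul_of_pos_right hM1 hpos
  have e4 := mul_lt_mul_of_pos_right hM2 hpos
  nlinarith

end WeylWalk

namespace WeylWalk

open MvPolynomial

/-! ### Rescaled terms, their ratios and the profile -/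

theorem Chamber.rho_length_le {n : ℕ} (x : Chamber n) : (rho n).length ≤ x.length :=
  Finset.sum_le_sum fun j _ => x.rho_le j

/-- The fraction `|y| / (|y| + n k)`. -/
noncomputable def Chamber.frac {n : ℕ} (y : Chamber n) (k : ℕ) : ℝ :=
  (y.length : ℝ) / (y.length + n * k : ℕ)

/-- The direction `y / |y|` and the mesh `1 / (|y| + n k)`. -/
noncomputable def Chamber.param {n : ℕ} (y : Chamber n) (k : ℕ) : (Fin n → ℝ) × ℝ :=
  (fun i => (y.coord i : ℝ) / y.length, ((y.length + n * k : ℕ) : ℝ)⁻¹)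

/-- The point `(n / q) (u v + (1 - u) / n)`. -/
noncomputable def profile {n : ℕ} (q : ℝ) (v : Fin n → ℝ) (u : ℝ) (i : Fin n) : ℝ :=
  n / q * (u * v i + (1 - u) / n)

theorem Chamber.frac_mem {n : ℕ} (y : Chamber n) (k : ℕ) : y.frac k ∈ Set.Icc (0 : ℝ) 1 := by
  refine ⟨by rw [Chamber.frac]; positivity, ?_⟩
  refine div_le_one_of_le₀ ?_ (by positivity)
  push_cast
  have : (0 : ℝ) ≤ n * k := by positivity
  linarith

/-- With `S = |y| + nk` and `u = |y| / S` one has `k / S = (1 - u) / n`. -/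
theorem profile_param {n : ℕ} {q : ℝ} {y : Chamber n} (hy : 0 < y.length) (k : ℕ) (i : Fin n) :
    profile q (y.param k).1 (y.frac k) i = n / q * (y.param k).2 * y.lift k i := by
  have hn : (n : ℝ) ≠ 0 := by exact_mod_cast i.pos.ne'
  have hy' : (0 : ℝ) < y.length := by exact_mod_cast hy
  have hS : (y.length : ℝ) + n * k ≠ 0 := by positivity
  simp only [profile, Chamber.param, Chamber.frac, Chamber.lift]
  push_cast
  field_simp
  ring

theorem greenTerm_rho_pos {n : ℕ} {q : ℝ} (hq : 0 < q) (hn : 0 < n) (y : Chamber n) (k : ℕ) :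
    0 < greenTerm q (rho n) y k := by
  rw [greenTerm, pathDet_rho_eq]
  have := eval_vandermondePoly_pos y
  have hn' : (0 : ℝ) < n := by exact_mod_cast hn
  positivity

/-- The Vandermonde product cancels. What remains is `(m + 1) ⋯ (m + n)` against `∏ (Y_i + 1)`, both
divided by `Sⁿ`: the first tends to 1, the second yields the product of the profile. -/
theorem greenTerm_rho_succ {n : ℕ} {q : ℝ} (hq : 0 < q) {y : Chamber n} (hy : 0 < y.length)
    (k : ℕ) :
    greenTerm q (rho n) y k *
        ∏ j ∈ Finset.range n, (1 + (1 + j - (rho n).length) * (y.param k).2) =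
      greenTerm q (rho n) y (k + 1) *
        ∏ i, (profile q (y.param k).1 (y.frac k) i + n / q * (y.param k).2) := by
  obtain ⟨m, hm⟩ := Nat.exists_eq_add_of_le (y.rho_length_le.trans (Nat.le_add_right _ (n * k)))
  have e1 : y.length + n * k - (rho n).length = m := by omega
  have e2 : y.length + n * (k + 1) - (rho n).length = m + n := by rw [mul_add]; omega
  have hSpos : (0 : ℝ) < (y.length + n * k : ℕ) := by exact_mod_cast Nat.add_pos_left hy _
  set S : ℝ := ((y.length + n * k : ℕ) : ℝ) with hS
  have hS' : S = (rho n).length + m := by rw [hS, hm]; push_cast; ring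
  have hh : (y.param k).2 = S⁻¹ := rfl
  have hD : ∏ j ∈ Finset.range n, (1 + (1 + j - (rho n).length) * (y.param k).2) =
      S⁻¹ ^ n * ((m + 1).ascFactorial n : ℝ) := by
    rw [Nat.ascFactorial_eq_prod_range, Finset.pow_eq_prod_const, Nat.cast_prod,
      ← Finset.prod_mul_distrib]
    refine Finset.prod_congr rfl fun j _ => ?_
    rw [hh]
    push_cast
    field_simp
    rw [hS']
    ring
  have hH : ∏ i, (profile q (y.param k).1 (y.frac k) i + n / q * (y.param k).2) =
      (n / q) ^ n * S⁻¹ ^ n * ∏ i : Fin n, ((y.lift k i + 1 : ℕ) : ℝ) := by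
    have : ∀ i, profile q (y.param k).1 (y.frac k) i + n / q * (y.param k).2 =
        n / q * S⁻¹ * ((y.lift k i + 1 : ℕ) : ℝ) := fun i => by
      rw [profile_param hy, hh]; push_cast; ring
    simp only [this, Finset.prod_mul_distrib, Finset.prod_const, Finset.card_univ,
      Fintype.card_fin]
  have hF : (∏ i, ((y.lift k i).factorial : ℝ)⁻¹) =
      (∏ i, ((y.lift (k + 1) i).factorial : ℝ)⁻¹) * ∏ i : Fin n, ((y.lift k i + 1 : ℕ) : ℝ) := by
    rw [← Finset.prod_mul_distrib]
    refine Finset.prod_congr rfl fun i _ => ?_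
    have : y.lift (k + 1) i = y.lift k i + 1 := rfl
    rw [this, Nat.factorial_succ]
    have : ((y.lift k i).factorial : ℝ) ≠ 0 := by exact_mod_cast Nat.factorial_ne_zero _
    push_cast
    field_simp
  have hqn : (q / n) ^ n * (n / q) ^ n = 1 := by
    rcases Nat.eq_zero_or_pos n with h | h
    · subst h; simp
    · have : (n : ℝ) ≠ 0 := by exact_mod_cast h.ne'
      rw [← mul_pow]
      field_simp
      simp
  rw [hD, hH, greenTerm, greenTerm, pathDet_rho_eq, pathDet_rho_eq, e1, e2, hF,
    ← Nat.factorial_mul_ascFactorial, pow_add]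
  push_cast
  linear_combination (-(q / n) ^ m * m.factorial * (m + 1).ascFactorial n *
    (∏ i, ((y.lift (k + 1) i).factorial : ℝ)⁻¹) * (∏ i : Fin n, ((y.lift k i : ℝ) + 1)) *
    eval (fun i => (y.coord i : ℝ)) (vandermondePoly n) * S⁻¹ ^ n) * hqn

/-- The ratio of the weights of the paths from `x` and from `ρ`. -/
noncomputable def weightRatio {n : ℕ} (q : ℝ) (x : Chamber n) (p : (Fin n → ℝ) × ℝ) (u : ℝ) : ℝ :=
  shiftedSchur x.coord (profile q p.1 u) (n / q * p.2) *
    ∏ l ∈ Finset.range (x.length - (rho n).length), (1 - ((rho n).length + l) * p.2)⁻¹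

theorem greenTerm_eq_mul {n : ℕ} {q : ℝ} (hq : 0 < q) (hn : 0 < n) {x y : Chamber n}
    (hy : 0 < y.length) (hxy : x.length ≤ y.length) (k : ℕ) :
    greenTerm q x y k =
      greenTerm q (rho n) y k * weightRatio q x (y.param k) (y.frac k) := by
  obtain ⟨a, ha⟩ := Nat.exists_eq_add_of_le x.rho_length_le
  obtain ⟨m, hm⟩ := Nat.exists_eq_add_of_le (hxy.trans (Nat.le_add_right _ (n * k)))
  have e1 : y.length + n * k - x.length = m := by omega
  have e2 : y.length + n * k - (rho n).length = m + a := by omega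
  have e3 : x.length - (rho n).length = a := by omega
  have hSpos : (0 : ℝ) < (y.length + n * k : ℕ) := by exact_mod_cast Nat.add_pos_left hy _
  have hn' : (n : ℝ) ≠ 0 := by exact_mod_cast hn.ne'
  set S : ℝ := ((y.length + n * k : ℕ) : ℝ) with hS
  have hS' : S = (rho n).length + a + m := by rw [hS, hm, ha]; push_cast; ring
  have hh : (y.param k).2 = S⁻¹ := rfl
  -- This scale makes `c Y` the profile, and `c ^ a` cancels the excess `(q / n) ^ a` and the growth
  -- `S ^ a` of the factorial ratio.
  set c : ℝ := n / q * S⁻¹ with hc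
  have hc0 : c ≠ 0 := by positivity
  have hprof : profile q (y.param k).1 (y.frac k) = fun i => c * y.lift k i :=
    funext fun i => by rw [profile_param hy, hh]
  have hx := pathDet_lift x y k c
  have hr := pathDet_rho_lift y k c
  set R := shiftedSchur x.coord (fun i => c * y.lift k i) c
  have hD : c ^ a * pathDet x.zcoord (fun i => y.zcoord i + k) =
      pathDet (rho n).zcoord (fun i => y.zcoord i + k) * R := by
    refine mul_left_cancel₀ (pow_ne_zero (rho n).length hc0) ?_
    rw [← mul_assoc, ← pow_add, ← ha, hx, ← mul_assoc, ← hr]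
    ring
  have hfac : ((m + a).factorial : ℝ) = m.factorial * ∏ l ∈ Finset.range a, ((m + a : ℕ) - l : ℝ) := by
    rw [← Nat.factorial_mul_descFactorial (Nat.le_add_left a m), Nat.add_sub_cancel, Nat.cast_mul,
      ← descPochhammer_eval_eq_descFactorial, descPochhammer_eval_eq_prod_range]
  have hE : (∏ l ∈ Finset.range a, ((m + a : ℕ) - l : ℝ)) *
      ∏ l ∈ Finset.range a, (1 - ((rho n).length + l) * S⁻¹)⁻¹ = S ^ a := by
    rw [Finset.pow_eq_prod_const, ← Finset.prod_mul_distrib]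
    refine Finset.prod_congr rfl fun l hl => ?_
    have h1 : (l : ℝ) < a := by exact_mod_cast Finset.mem_range.1 hl
    have h2 : ((m + a : ℕ) - l : ℝ) = S * (1 - ((rho n).length + l) * S⁻¹) := by
      field_simp
      rw [hS']
      push_cast
      ring
    -- Guarantees that the inverted factor is nonzero, so the inverse really cancels.
    have h3 : (0 : ℝ) < (m + a : ℕ) - l := by
      push_cast
      have : (0 : ℝ) ≤ m := by positivity
      linarith
    rw [h2] at h3
    have h4 := (pos_iff_pos_of_mul_pos h3).1 hSpos
    rw [h2, mul_inv_cancel_right₀ h4.ne']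
  have hSc : (q / n) ^ a * c ^ a * S ^ a = 1 := by
    rw [← mul_pow, ← mul_pow, hc]
    field_simp
    simp
  rw [weightRatio, hprof, hh, ← hc, greenTerm, greenTerm, e1, e2, e3, hfac, pow_add]
  linear_combination (-((q / n) ^ m * m.factorial * pathDet x.zcoord fun i => y.zcoord i + k)) * hSc
    + (q / n) ^ m * (q / n) ^ a * m.factorial * S ^ a * hD
    - (q / n) ^ m * (q / n) ^ a * m.factorial *
      (pathDet (rho n).zcoord fun i => y.zcoord i + k) * R * hE

theorem continuous_profile {n : ℕ} (q : ℝ) :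
    Continuous fun z : (Fin n → ℝ) × ℝ => profile q z.1 z.2 := by
  unfold profile
  fun_prop

theorem continuousAt_weightRatio {n : ℕ} (q : ℝ) (x : Chamber n) (v : Fin n → ℝ) (u : ℝ) :
    ContinuousAt (fun z : ((Fin n → ℝ) × ℝ) × ℝ => weightRatio q x z.1 z.2) ((v, 0), u) := by
  have h1 : Continuous fun z : ((Fin n → ℝ) × ℝ) × ℝ => profile q z.1.1 z.2 :=
    (continuous_profile q).comp₂ (continuous_fst.comp continuous_fst) continuous_snd
  have h2 : Continuous fun z : ((Fin n → ℝ) × ℝ) × ℝ => (n : ℝ) / q * z.1.2 :=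
    continuous_const.mul (continuous_snd.comp continuous_fst)
  have h3 : Continuous fun z : ((Fin n → ℝ) × ℝ) × ℝ =>
      shiftedSchur x.coord (profile q z.1.1 z.2) (n / q * z.1.2) :=
    (continuous_shiftedSchur x.coord).comp₂ h1 h2
  have h4 : ∀ l : ℕ, Continuous fun z : ((Fin n → ℝ) × ℝ) × ℝ =>
      1 - ((rho n).length + l : ℝ) * z.1.2 := fun l => by fun_prop
  have h5 : ∀ l : ℕ, ContinuousAt (fun z : ((Fin n → ℝ) × ℝ) × ℝ =>
      (1 - ((rho n).length + l : ℝ) * z.1.2)⁻¹) ((v, 0), u) := fun l =>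
    (h4 l).continuousAt.inv₀ (by simp)
  have h6 : ContinuousAt (fun z : ((Fin n → ℝ) × ℝ) × ℝ =>
      ∏ l ∈ Finset.range (x.length - (rho n).length),
        (1 - ((rho n).length + l : ℝ) * z.1.2)⁻¹) ((v, 0), u) := by
    simp only [ContinuousAt]
    exact tendsto_finsetProd _ fun l _ => h5 l
  exact h3.continuousAt.mul h6

theorem weightRatio_zero {n : ℕ} (q : ℝ) (x : Chamber n) (v : Fin n → ℝ) (u : ℝ) :
    weightRatio q x (v, 0) u = eval (profile q v u) (schur x.subRho) := by
  simp [weightRatio, shiftedSchur_zero, alternantQuot_coord]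

/-- The profile is affine in `u` and equals the constant `q⁻¹` at `u = 0`. -/
theorem profile_smul {n : ℕ} (hn : 0 < n) {q : ℝ} (v : Fin n → ℝ) (s u : ℝ) (i : Fin n) :
    profile q v (s * u) i = s * profile q v u i + (1 - s) * q⁻¹ := by
  have : (n : ℝ) ≠ 0 := by exact_mod_cast hn.ne'
  simp only [profile]
  field_simp
  ring

theorem Simplex.profile_nonneg {n : ℕ} {q : ℝ} (hq0 : 0 < q) (y : Simplex n) {u : ℝ} (hu : 0 ≤ u)
    (hu1 : u ≤ 1) (i : Fin n) : 0 ≤ profile q y.1 u i := by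
  have h1 := y.nonneg i
  have h2 : 0 ≤ 1 - u := by linarith
  simp only [profile]
  positivity

/-- Going from `u'` down to `u = s u'` mixes each coordinate with `q⁻¹ > 1`. Weighted AM-GM bounds
the product below by `(∏ profile u') ^ s * q⁻¹ ^ (n (1 - s))`. -/
theorem Simplex.one_lt_prod_profile {n : ℕ} {q : ℝ} (hq0 : 0 < q) (hq1 : q < 1) (y : Simplex n)
    {u u' : ℝ} (hu : 0 ≤ u) (huu' : u < u') (hu' : u' ≤ 1) (h : 1 ≤ ∏ i, profile q y.1 u' i) :
    1 < ∏ i, profile q y.1 u i := by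
  have hpos : 0 < u' := hu.trans_lt huu'
  set s : ℝ := u / u' with hs
  have hs0 : 0 ≤ s := by positivity
  have hs1 : s < 1 := by rw [hs, div_lt_one hpos]; exact huu'
  have hsu : s * u' = u := by rw [hs]; field_simp
  have ha := y.profile_nonneg hq0 hpos.le hu'
  have hqi : 1 < q⁻¹ := (one_lt_inv₀ hq0).2 hq1
  have hle : ∀ i, profile q y.1 u' i ^ s * q⁻¹ ^ (1 - s) ≤ profile q y.1 u i := fun i => by
    rw [← hsu, profile_smul y.pos]
    exact Real.geom_mean_le_arith_mean2_weighted hs0 (by linarith) (ha i) (by positivity)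
      (by ring)
  refine lt_of_lt_of_le ?_ (Finset.prod_le_prod
    (fun i _ => mul_nonneg (Real.rpow_nonneg (ha i) _) (by positivity)) fun i _ => hle i)
  rw [Finset.prod_mul_distrib, Real.finsetProd_rpow _ _ (fun i _ => ha i), Finset.prod_const,
    Finset.card_univ, Fintype.card_fin]
  exact one_lt_mul_of_le_of_lt (Real.one_le_rpow h hs0)
    (one_lt_pow₀ (Real.one_lt_rpow hqi (by linarith)) y.pos.ne')

theorem exists_phi_eq_profile {n : ℕ} {q : ℝ} (hq0 : 0 < q) (hq1 : q < 1) (y : Simplex n) :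
    ∃ u : ℝ, 0 < u ∧ u ≤ 1 ∧ (phi hq0 hq1 y).1 = profile q y.1 u := by
  obtain ⟨ht, -⟩ := (existsUnique_shift hq0 hq1 y).choose_spec.1
  have hphi : (phi hq0 hq1 y).1 = shifted q y.1 (existsUnique_shift hq0 hq1 y).choose := rfl
  rw [hphi]
  set t := (existsUnique_shift hq0 hq1 y).choose
  have hn : (0 : ℝ) < n := by exact_mod_cast y.pos
  have hnt : 0 ≤ n * t := by positivity
  have h1 : 0 < 1 + n * t := by positivity
  refine ⟨(1 + n * t)⁻¹, by positivity, inv_le_one_of_one_le₀ (by linarith), funext fun i => ?_⟩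
  simp only [shifted, profile]
  field_simp
  ring

/-- The source of uniformity in `k`: compactness makes the neighbourhood of `(y', 0)` independent of
`u`, and the mesh is at most `1 / |y|` for every `k`. -/
theorem ConvergesTo.eventually_forall {n : ℕ} {y : ℕ → Chamber n} {y' : Simplex n}
    (hy : ConvergesTo y y') {K : Set ℝ} (hK : IsCompact K)
    {P : (Fin n → ℝ) × ℝ → ℝ → Prop} (hP : ∀ u ∈ K, ∀ᶠ z in 𝓝 ((y'.1, (0 : ℝ)), u), P z.1 z.2) :
    ∀ᶠ d in atTop, ∀ k, (y d).frac k ∈ K → P ((y d).param k) ((y d).frac k) := by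
  have h := hK.eventually_forall_of_forall_eventually hP
  rw [nhds_prod_eq, eventually_prod_iff] at h
  obtain ⟨Pv, hPv, Ph, hPh, hP'⟩ := h
  have h1 : Tendsto (fun d i => ((y d).coord i : ℝ) / (y d).length) atTop (𝓝 y'.1) :=
    tendsto_pi_nhds.2 hy.2
  obtain ⟨ε, hε, hball⟩ := Metric.eventually_nhds_iff.1 hPh
  have h2 : Tendsto (fun d => ((y d).length : ℝ)⁻¹) atTop (𝓝 0) :=
    tendsto_inv_atTop_zero.comp (tendsto_natCast_atTop_atTop.comp hy.1)
  filter_upwards [h1.eventually hPv, h2.eventually_lt_const hε, hy.1.eventually_gt_atTop 0] with d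
    hd1 hd2 hd3 k hk
  refine hP' hd1 (hball ?_) _ hk
  have hpos : (0 : ℝ) < (y d).length := by exact_mod_cast hd3
  rw [Real.dist_eq, sub_zero, abs_of_nonneg (by positivity)]
  refine lt_of_le_of_lt (inv_anti₀ hpos ?_) hd2
  push_cast
  have : (0 : ℝ) ≤ n * k := by positivity
  linarith

end WeylWalk

namespace WeylWalk

open MvPolynomial

/-! ### Growth and decay of the weights, and the limit -/

theorem continuous_prod_profile_add {n : ℕ} (q : ℝ) :
    Continuous fun z : ((Fin n → ℝ) × ℝ) × ℝ =>
      ∏ i, (profile q z.1.1 z.2 i + n / q * z.1.2) := by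
  unfold profile
  fun_prop

theorem continuous_prod_one_add (n : ℕ) (c : ℝ) :
    Continuous fun z : ((Fin n → ℝ) × ℝ) × ℝ =>
      ∏ j ∈ Finset.range n, (1 + (1 + j - c) * z.1.2) := by
  fun_prop

theorem continuous_prod_profile {n : ℕ} (q : ℝ) (v : Fin n → ℝ) :
    Continuous fun u => ∏ i, profile q v u i := by
  unfold profile
  fun_prop

theorem ConvergesTo.greenTerm_growth {n : ℕ} {q : ℝ} (hq0 : 0 < q) (hq1 : q < 1)
    {y : ℕ → Chamber n} {y' : Simplex n} (hy : ConvergesTo y y') {u₀ : ℝ} (hu₀ : 0 ≤ u₀)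
    (h1 : ∏ i, profile q y'.1 u₀ i = 1) {ε : ℝ} (hε : 0 < ε) :
    ∃ c, 0 ≤ c ∧ c < 1 ∧ ∀ᶠ d in atTop, ∀ k, u₀ + ε ≤ (y d).frac k →
      greenTerm q (rho n) (y d) k ≤ c * greenTerm q (rho n) (y d) (k + 1) := by
  have hK : IsCompact (Set.Icc (u₀ + ε) 1) := isCompact_Icc
  -- Negation turns the lower bound into an upper bound `-c' < 1` on the product; `(1 - c') / 2`
  -- lies midway between `-c'` and 1. The maximum with 0 covers an empty interval, where `c'` may be
  -- large.
  obtain ⟨c', hc', hle⟩ := hK.exists_forall_le' (continuous_prod_profile q y'.1).neg.continuousOn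
    (a := -1) fun u hu => by
      by_contra hlt
      exact (y'.one_lt_prod_profile hq0 hq1 hu₀ (by linarith [hu.1]) hu.2
        (neg_le_neg_iff.1 (not_lt.1 hlt))).ne' h1
  have hc : (1 - c') / 2 ≤ max ((1 - c') / 2) 0 := le_max_left _ _
  refine ⟨max ((1 - c') / 2) 0, le_max_right _ _, max_lt (by linarith) one_pos, ?_⟩
  set c := max ((1 - c') / 2) 0
  have hev := hy.eventually_forall hK (P := fun p u =>
    0 < ∏ j ∈ Finset.range n, (1 + (1 + j - (rho n).length) * p.2) ∧
    ∏ i, (profile q p.1 u i + n / q * p.2) <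
      c * ∏ j ∈ Finset.range n, (1 + (1 + j - (rho n).length) * p.2)) fun u hu => by
    have hD := (continuous_prod_one_add n (rho n).length).continuousAt (x := ((y'.1, (0 : ℝ)), u))
    have hH := (continuous_prod_profile_add q).continuousAt (x := ((y'.1, (0 : ℝ)), u))
    refine (hD.eventually_const_lt (by simp)).and (hH.eventually_lt (hD.const_mul c) ?_)
    have : c' ≤ -∏ i, profile q y'.1 u i := hle u hu
    simp only [mul_zero, add_zero, Finset.prod_const_one, mul_one]
    linarith
  filter_upwards [hev, hy.1.eventually_gt_atTop 0] with d hd hd0 k hk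
  obtain ⟨hD, hlt⟩ := hd k ⟨hk, ((y d).frac_mem k).2⟩
  refine le_of_mul_le_mul_right ?_ hD
  rw [greenTerm_rho_succ hq0 hd0, mul_right_comm, mul_comm]
  exact mul_le_mul_of_nonneg_right hlt.le (greenTerm_rho_pos hq0 y'.pos _ _).le

theorem ConvergesTo.greenTerm_decay {n : ℕ} {q : ℝ} (hq0 : 0 < q) (hq1 : q < 1)
    {y : ℕ → Chamber n} {y' : Simplex n} (hy : ConvergesTo y y') {u₀ : ℝ} (hu₀ : u₀ ≤ 1)
    (h1 : ∏ i, profile q y'.1 u₀ i = 1) {ε : ℝ} (hε : 0 < ε) :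
    ∃ c, 0 ≤ c ∧ c < 1 ∧ ∀ᶠ d in atTop, ∀ k, (y d).frac k ≤ u₀ - ε →
      greenTerm q (rho n) (y d) (k + 1) ≤ c * greenTerm q (rho n) (y d) k := by
  have hK : IsCompact (Set.Icc 0 (u₀ - ε)) := isCompact_Icc
  obtain ⟨a, ha, hle⟩ := hK.exists_forall_le' (continuous_prod_profile q y'.1).continuousOn
    (a := 1) fun u hu => y'.one_lt_prod_profile hq0 hq1 hu.1 (by linarith [hu.2]) hu₀ h1.ge
  -- As `a > 1` bounds the product from below, this constant is less than 1 while its product with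
  -- `a` exceeds 1.
  have hc0 : 0 < 2 / (1 + a) := by positivity
  have hca : 1 < 2 / (1 + a) * a := by rw [div_mul_eq_mul_div, one_lt_div (by linarith)]; linarith
  refine ⟨2 / (1 + a), hc0.le, (div_lt_one (by linarith)).2 (by linarith), ?_⟩
  set c := 2 / (1 + a)
  have hev := hy.eventually_forall hK (P := fun p u =>
    0 < ∏ i, (profile q p.1 u i + n / q * p.2) ∧
    ∏ j ∈ Finset.range n, (1 + (1 + j - (rho n).length) * p.2) <
      c * ∏ i, (profile q p.1 u i + n / q * p.2)) fun u hu => by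
    have hD := (continuous_prod_one_add n (rho n).length).continuousAt (x := ((y'.1, (0 : ℝ)), u))
    have hH := (continuous_prod_profile_add q).continuousAt (x := ((y'.1, (0 : ℝ)), u))
    have hu' := hle u hu
    refine (hH.eventually_const_lt ?_).and (hD.eventually_lt (hH.const_mul c) ?_)
    · simp only [mul_zero, add_zero]
      linarith
    · simp only [mul_zero, add_zero, Finset.prod_const_one]
      exact hca.trans_le (mul_le_mul_of_nonneg_left hu' hc0.le)
  filter_upwards [hev, hy.1.eventually_gt_atTop 0] with d hd hd0 k hk
  obtain ⟨hH, hlt⟩ := hd k ⟨((y d).frac_mem k).1, hk⟩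
  refine le_of_mul_le_mul_right ?_ hH
  rw [← greenTerm_rho_succ hq0 hd0, mul_right_comm, mul_comm]
  exact mul_le_mul_of_nonneg_right hlt.le (greenTerm_rho_pos hq0 y'.pos _ _).le

theorem Chamber.abs_frac_succ_sub_le {n : ℕ} {y : Chamber n} (hy : 0 < y.length) (k : ℕ) :
    |y.frac (k + 1) - y.frac k| ≤ n / y.length := by
  have hN : (0 : ℝ) < y.length := by exact_mod_cast hy
  have hk : (0 : ℝ) ≤ n * k := by positivity
  have hn : (0 : ℝ) ≤ n := by positivity
  have h : y.frac k - y.frac (k + 1) = (y.length / (y.length + n * k)) *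
      (n / (y.length + n * (k + 1))) := by
    simp only [Chamber.frac]
    push_cast
    field_simp
    ring
  rw [abs_sub_comm, h, abs_of_nonneg (by positivity)]
  refine (mul_le_of_le_one_left (by positivity) (div_le_one_of_le₀ (by linarith)
    (by positivity))).trans ?_
  gcongr
  nlinarith

theorem ConvergesTo.tendsto_green_ratio {n : ℕ} {q : ℝ} (hq0 : 0 < q) (hq1 : q < 1)
    {y : ℕ → Chamber n} {y' : Simplex n} (hy : ConvergesTo y y') (x : Chamber n) :
    Tendsto (fun d => (green q x (y d)).toReal / (green q (rho n) (y d)).toReal) atTop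
      (𝓝 (eval (phi hq0 hq1 y').1 (schur x.subRho))) := by
  obtain ⟨u₀, hu₀, hu₁, hphi⟩ := exists_phi_eq_profile hq0 hq1 y'
  have hprod : ∏ i, profile q y'.1 u₀ i = 1 := by
    rw [← hphi]
    exact (phi hq0 hq1 y').2.2.2.1
  have hn := y'.pos
  have hsum : ∀ d, HasSum (greenTerm q (rho n) (y d)) (green q (rho n) (y d)).toReal := fun d =>
    hasSum_greenTerm hn hq0 hq1 (y d).rho_length_le
  have hcontG : Continuous fun u => weightRatio q x (y'.1, 0) u :=
    continuous_iff_continuousAt.2 fun u =>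
      (continuousAt_weightRatio q x y'.1 u).comp (f := fun u => ((y'.1, (0 : ℝ)), u))
        (by fun_prop)
  rw [hphi, ← weightRatio_zero]
  set L := weightRatio q x (y'.1, 0) u₀
  obtain ⟨B, hB⟩ := (isCompact_Icc (a := (0 : ℝ)) (b := 1)).exists_bound_of_continuousOn
    hcontG.continuousOn
  have key : Tendsto (fun d => (∑' k, greenTerm q (rho n) (y d) k *
      weightRatio q x ((y d).param k) ((y d).frac k)) / ∑' k, greenTerm q (rho n) (y d) k)
      atTop (𝓝 L) := by
    refine tendsto_weighted_average (u := fun d k => (y d).frac k) (u₀ := u₀) (B := B + 1)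
      (Eventually.of_forall fun d => (hsum d).summable)
      (Eventually.of_forall fun d k => (greenTerm_rho_pos hq0 hn _ _).le)
      (Eventually.of_forall fun d => (hsum d).summable.tsum_pos
        (fun k => (greenTerm_rho_pos hq0 hn _ _).le) 0 (greenTerm_rho_pos hq0 hn _ _))
      ?_ ?_ (fun ε hε => hy.greenTerm_decay hq0 hq1 hu₁ hprod hε)
      (fun ε hε => hy.greenTerm_growth hq0 hq1 hu₀.le hprod hε) ?_ ?_
    · filter_upwards [hy.1.eventually_gt_atTop 0] with d hd
      have : ((y d).length : ℝ) ≠ 0 := by exact_mod_cast hd.ne'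
      simpa [Chamber.frac, this] using hu₁
    · intro η hη
      have h2 : Tendsto (fun d => (n : ℝ) / ((y d).length : ℝ)) atTop (𝓝 0) :=
        tendsto_const_nhds.div_atTop (tendsto_natCast_atTop_atTop.comp hy.1)
      filter_upwards [hy.1.eventually_gt_atTop 0, h2.eventually_le_const hη] with d hd hd' k
      exact (Chamber.abs_frac_succ_sub_le hd k).trans hd'
    · have h := hy.eventually_forall (isCompact_Icc (a := (0 : ℝ)) (b := 1))
        (P := fun p u => |weightRatio q x p u| < B + 1) fun u hu =>
          (continuousAt_weightRatio q x y'.1 u).abs.eventually_lt_const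
            (lt_of_le_of_lt (hB u hu) (lt_add_one B))
      filter_upwards [h] with d hd k
      exact (hd k ((y d).frac_mem k)).le
    · intro δ hδ
      obtain ⟨ε, hε, hG⟩ := Metric.continuousAt_iff.1 hcontG.continuousAt δ hδ
      -- Half the radius gives a compact ball inside the open one supplied by continuity.
      refine ⟨ε / 2, by positivity, ?_⟩
      have h := hy.eventually_forall (isCompact_closedBall u₀ (ε / 2))
        (P := fun p u => |weightRatio q x p u - L| < δ) fun u hu =>
          ((continuousAt_weightRatio q x y'.1 u).sub continuousAt_const).abs.eventually_lt_const
            (hG (lt_of_le_of_lt hu (half_lt_self hε)))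
      filter_upwards [h] with d hd k hk
      exact (hd k (Metric.mem_closedBall.2 hk.le)).le
  -- The ratio of Green kernels is this average as soon as `|y| ≥ |x|` and `|y| > 0`.
  refine key.congr' ?_
  filter_upwards [hy.1.eventually_gt_atTop 0, hy.1.eventually_ge_atTop x.length] with d hd hd'
  rw [(hsum d).tsum_eq, ← (hasSum_greenTerm hn hq0 hq1 hd').tsum_eq]
  simp only [greenTerm_eq_mul hq0 hn hd hd']

theorem green_rho_pos {n : ℕ} (hn : 0 < n) {q : ℝ} (hq : 0 < q) (y : Chamber n) :
    0 < green q (rho n) y := by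
  rw [green_eq_tsum hn hq y.rho_length_le, pos_iff_ne_zero, Ne, ENNReal.tsum_eq_zero]
  push Not
  exact ⟨0, (ENNReal.ofReal_pos.2 (greenTerm_rho_pos hq hn y 0)).ne'⟩

end WeylWalk

theorem mainTheorem4 (n : ℕ) (hn : 3 ≤ n) (q : ℝ) (hq0 : 0 < q) (hq1 : q < 1)
    (y : ℕ → WeylWalk.Chamber n) (y' : WeylWalk.Simplex n) (hy : WeylWalk.ConvergesTo y y')
    (x : WeylWalk.Chamber n) :
    (∀ d : ℕ, 0 < WeylWalk.green q (WeylWalk.rho n) (y d) ∧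
      WeylWalk.green q (WeylWalk.rho n) (y d) < ⊤ ∧ WeylWalk.green q x (y d) < ⊤) ∧
    Filter.Tendsto
      (fun d : ℕ => (WeylWalk.green q x (y d)).toReal /
        (WeylWalk.green q (WeylWalk.rho n) (y d)).toReal)
      Filter.atTop
      (nhds (MvPolynomial.eval (WeylWalk.phi hq0 hq1 y').1 (WeylWalk.schur x.subRho))) := by
  have hn0 : 0 < n := by omega
  exact ⟨fun d => ⟨WeylWalk.green_rho_pos hn0 hq0 (y d),
    WeylWalk.green_lt_top hn0 hq1 _ _, WeylWalk.green_lt_top hn0 hq1 _ _⟩,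
    hy.tendsto_green_ratio hq0 hq1 x⟩
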